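/- Let $k$ be an arbitrary field (not assumed perfect) and let $X$ be a normal projective variety over $k$, i.e. an integral normal scheme, projective over $k$; put $d=\dim X$. An $\mathbb R$-Weil divisor on $X$ is a finite formal sum $D=\sum_i a_iE_i$ with $a_i\in\mathbb R$ and $E_i$ prime divisors, and $D\le D'$ means that the inequality holds for the coefficients at every prime divisor. For such a $D$ put $$\Gamma(X,\mathcal O_X(D))=\{f\in k(X)^{*}\mid \operatorname{div}(f)+D\ge 0\}\cup\{0\}\subset k(X),$$ $$\operatorname{Vol}(D)=\limsup_{n\to\infty}\frac{\dim_k\Gamma(X,\mathcal O_X(nD))}{n^d/d!},$$ and call $D$ big if $\operatorname{Vol}(D)>0$. (The limsup is in fact a limit.) Let $D_1\le D_2$ be big $\mathbb R$-Weil divisors on $X$ with $\operatorname{Vol}(D_1)=\operatorname{Vol}(D_2)$. Then $$\Gamma(X,\mathcal O_X(nD_1))=\Gamma(X,\mathcal O_X(nD_2))$$ as subspaces of $k(X)$, for all $n\in\mathbb N$. -/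

import Mathlib

open AlgebraicGeometry CategoryTheory Order

universe u

noncomputable section

namespace BigDivisor

/-- The standard grading of `k[x₀, …, xₙ]`. -/
abbrev grading (k : Type u) [Field k] (n : ℕ) : ℕ → Submodule k (MvPolynomial (Fin (n + 1)) k) :=
  MvPolynomial.homogeneousSubmodule (Fin (n + 1)) k

instance (k : Type u) [Field k] (n : ℕ) : GradedAlgebra (grading k n) :=
  MvPolynomial.gradedAlgebra

/-- Projective space `ℙⁿ_k = Proj k[x₀, …, xₙ]`. -/
abbrev projectiveSpace (k : Type u) [Field k] (n : ℕ) : Scheme.{u} :=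
  Proj (grading k n)

/-- The structure morphism `ℙⁿ_k ⟶ Spec k`. -/
def projectiveSpaceStr (k : Type u) [Field k] (n : ℕ) :
    projectiveSpace k n ⟶ Spec (CommRingCat.of k) :=
  Proj.toSpecZero (grading k n) ≫
    Spec.map (CommRingCat.ofHom (algebraMap k (grading k n 0)))

/-- A `k`-scheme is projective if it is isomorphic over `k` to a closed subscheme of some
projective space `ℙⁿ_k`. -/
def IsProjectiveOver {k : Type u} [Field k] {X : Scheme.{u}}
    (f : X ⟶ Spec (CommRingCat.of k)) : Prop :=
  ∃ (n : ℕ) (i : X ⟶ projectiveSpace k n), IsClosedImmersion i ∧ i ≫ projectiveSpaceStr k n = f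

instance (k : Type u) [Field k] (n : ℕ) : LocallyOfFiniteType (projectiveSpaceStr k n) := by
  have h0 : Function.Surjective (algebraMap k (grading k n 0)) := by
    rintro ⟨p, hp⟩
    have hp' : p.totalDegree = 0 :=
      Nat.le_zero.mp (MvPolynomial.IsHomogeneous.totalDegree_le
        ((MvPolynomial.mem_homogeneousSubmodule 0 p).mp hp))
    refine ⟨p.coeff 0, Subtype.ext ?_⟩
    exact (MvPolynomial.totalDegree_eq_zero_iff_eq_C.mp hp').symm
  have : IsScalarTower k (grading k n 0) (MvPolynomial (Fin (n + 1)) k) :=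
    IsScalarTower.of_algebraMap_eq (R := k) (S := grading k n 0)
      (A := MvPolynomial (Fin (n + 1)) k) fun _ => rfl
  have : Algebra.FiniteType (grading k n 0) (MvPolynomial (Fin (n + 1)) k) :=
    Algebra.FiniteType.of_restrictScalars_finiteType k _ _
  have : LocallyOfFiniteType
      (Spec.map (CommRingCat.ofHom (algebraMap k (grading k n 0)))) := by
    rw [HasRingHomProperty.Spec_iff (P := @LocallyOfFiniteType)]
    exact RingHom.FiniteType.of_surjective _ h0
  unfold projectiveSpaceStr
  infer_instance

lemma IsProjectiveOver.locallyOfFiniteType {k : Type u} [Field k] {X : Scheme.{u}}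
    {f : X ⟶ Spec (CommRingCat.of k)} (hf : IsProjectiveOver f) : LocallyOfFiniteType f := by
  obtain ⟨n, i, hi, rfl⟩ := hf
  infer_instance

end BigDivisor

/-- A normal projective variety over the field `k`: an integral normal scheme, projective over
`k`. It is neither assumed to be geometrically integral nor geometrically normal. -/
structure NormalProjectiveVariety (k : Type u) [Field k] where
  /-- The underlying scheme. -/
  X : Scheme.{u}
  /-- The structure morphism. -/
  str : X ⟶ Spec (CommRingCat.of k)
  isIntegral : IsIntegral X
  isProjective : BigDivisor.IsProjectiveOver str
  isNormal : ∀ x : X, IsIntegrallyClosed (X.presheaf.stalk x)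

namespace NormalProjectiveVariety

variable {k : Type u} [Field k] (V : NormalProjectiveVariety k)

instance : IsIntegral V.X := V.isIntegral

instance : LocallyOfFiniteType V.str := V.isProjective.locallyOfFiniteType

instance : IsLocallyNoetherian V.X :=
  LocallyOfFiniteType.isLocallyNoetherian V.str

/-- The field of rational functions `k(X)`. -/
abbrev functionField : Type u := V.X.functionField

/-- The ring homomorphism `k → Γ(X, 𝒪_X)` given by the structure morphism. -/
def scalars : k →+* Γ(V.X, ⊤) :=
  V.str.appTop.hom.comp (Scheme.ΓSpecIso (CommRingCat.of k)).inv.hom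

instance : Algebra k V.functionField :=
  ((V.X.presheaf.germ ⊤ (genericPoint V.X) trivial).hom.comp V.scalars).toAlgebra

/-- The dimension of `X`. -/
def dim : ℕ := ((topologicalKrullDim V.X).unbotD 0).toNat

/-- The prime divisors of `X`, given by their generic points, which are the points of
codimension one. -/
abbrev PrimeDivisor : Type u := {x : V.X // coheight x = 1}

/-- The `ℝ`-Weil divisors on `X`: finite formal real linear combinations of prime divisors, with
the coefficientwise order. -/
abbrev RWeilDivisor : Type u := V.PrimeDivisor →₀ ℝ

instance (E : V.PrimeDivisor) : IsDiscreteValuationRing (V.X.presheaf.stalk E.1) := by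
  have h1 : ringKrullDim (V.X.presheaf.stalk E.1) = 1 := by
    rw [ringKrullDim_stalk_eq_coheight E.1, E.2]; rfl
  have : Ring.KrullDimLE 1 (V.X.presheaf.stalk E.1) := krullDimLE_of_coheight_le E.2.le
  have := V.isNormal E.1
  have hf : ¬ IsField (V.X.presheaf.stalk E.1) := by
    intro h
    rw [ringKrullDim_eq_zero_of_isField h] at h1
    exact zero_ne_one h1
  have : Ring.DimensionLEOne (V.X.presheaf.stalk E.1) :=
    ⟨fun hP hP' => Ring.krullDimLE_one_iff_of_noZeroDivisors.mp ‹_› _ hP hP'⟩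
  have : IsDedekindDomain (V.X.presheaf.stalk E.1) := {}
  exact ((IsDiscreteValuationRing.TFAE (V.X.presheaf.stalk E.1) hf).out 0 2).mpr this

/-- The space of global sections
`Γ(X, 𝒪_X(D)) = {f ∈ k(X)ˣ ∣ div f + D ≥ 0} ∪ {0}` for an `ℝ`-Weil divisor `D`,
as a `k`-subspace of `k(X)`. -/
def sections (D : V.RWeilDivisor) : Submodule k V.functionField where
  carrier := {f | f ≠ 0 → ∀ E : V.PrimeDivisor, 0 ≤ (Scheme.ord f E.1 : ℝ) + D E}
  zero_mem' h := absurd rfl h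
  add_mem' {f g} hf hg hfg E := by
    by_cases hf0 : f = 0
    · subst hf0
      rw [zero_add] at hfg ⊢
      exact hg hfg E
    by_cases hg0 : g = 0
    · subst hg0
      rw [add_zero] at hfg ⊢
      exact hf hfg E
    have h := Scheme.ord_add (x := E.1) hfg
    have h1 := hf hf0 E
    have h2 := hg hg0 E
    rcases min_le_iff.mp h with h | h
    · have : (Scheme.ord f E.1 : ℝ) ≤ Scheme.ord (f + g) E.1 := by exact_mod_cast h
      linarith
    · have : (Scheme.ord g E.1 : ℝ) ≤ Scheme.ord (f + g) E.1 := by exact_mod_cast h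
      linarith
  smul_mem' c f hf hcf E := by
    have hne : Nonempty (⊤ : V.X.Opens) := ⟨⟨genericPoint V.X, trivial⟩⟩
    have hsmul : c • f = V.scalars c • f := by
      rw [Algebra.smul_def, Algebra.smul_def]; rfl
    have hf0 : f ≠ 0 := by rintro rfl; exact hcf (smul_zero c)
    rw [hsmul] at hcf ⊢
    have hc0 : V.scalars c ≠ 0 := fun h => hcf (by rw [h, zero_smul])
    have h := Scheme.ord_le_smul (x := E.1) (U := ⊤) trivial hc0 f
    have h' : (Scheme.ord f E.1 : ℝ) ≤ Scheme.ord (V.scalars c • f) E.1 := by exact_mod_cast h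
    have := hf hf0 E
    linarith

/-- The volume
`vol D = limsup_n dim_k Γ(X, 𝒪_X(nD)) / (n ^ d / d!)`, where `d = dim X`. It is taken in `[0, ∞]`,
so that no boundedness is needed for it to be defined. -/
def vol (D : V.RWeilDivisor) : ENNReal :=
  Filter.limsup
    (fun n : ℕ => (Module.finrank k (V.sections (n • D)) : ENNReal) /
      ((n : ENNReal) ^ V.dim / (V.dim.factorial : ENNReal)))
    Filter.atTop

/-- An `ℝ`-Weil divisor is big if its volume is positive. -/
def IsBig (D : V.RWeilDivisor) : Prop := 0 < V.vol D

end NormalProjectiveVariety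

end

/-!
If `f ∈ Γ(m D₂)` does not belong to `Γ(m D₁)`, then along some prime divisor `E` it has a larger
pole than `m D₁` allows. As `D₁` is big, the function field is algebraic over the field generated by
the ratios of sections of the multiples of `D₁`, and the products of powers of a transcendence basis
of such ratios and of their common denominator show that `dim Γ(r P D₁) ≥ (r + 1) ^ d` for some `P`
and all `r`. On the other hand, the order of vanishing along `E` of the nonzero sections of `n D₁`
is at most `C (n + 1)`. Hence, if `j` is a large multiple of `l`, no zero along `E` of a section of
`l D₁` compensates the pole of `f ^ j`, so that `f ^ j Γ(l D₁)` is a subspace of `Γ(n D₂)`,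
`n = m j + l`, that meets `Γ(n D₁)` only in zero. Its dimension is at least a positive multiple of
`n ^ d`, which gives `Vol(D₁) < Vol(D₂)`.
-/

namespace BigDivisor

section PolynomialGrowth

/-- The sequence `a` grows at most like `n ^ d`. The shift by one makes the bound meaningful at
`n = 0`, so that no exceptional indices have to be excluded. -/
def HasPolynomialGrowth (a : ℕ → ℕ) (d : ℕ) : Prop :=
  ∃ C, ∀ n, a n ≤ C * (n + 1) ^ d

lemma HasPolynomialGrowth.comp_affine {a : ℕ → ℕ} {d : ℕ} (ha : HasPolynomialGrowth a d)
    (M m : ℕ) : HasPolynomialGrowth (fun n => a (M * n + m)) d := by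
  obtain ⟨C, hC⟩ := ha
  refine ⟨C * (M + m + 1) ^ d, fun n => ?_⟩
  calc a (M * n + m) ≤ C * (M * n + m + 1) ^ d := hC _
    _ ≤ C * ((M + m + 1) * (n + 1)) ^ d := by gcongr; nlinarith [Nat.zero_le (m * n)]
    _ = C * (M + m + 1) ^ d * (n + 1) ^ d := by rw [mul_pow]; ring

lemma HasPolynomialGrowth.of_le {a b : ℕ → ℕ} {d : ℕ} (hb : HasPolynomialGrowth b d)
    (hab : ∀ n, a n ≤ b n) : HasPolynomialGrowth a d :=
  let ⟨C, hC⟩ := hb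
  ⟨C, fun n => (hab n).trans (hC n)⟩

end PolynomialGrowth

section TotalDegree

open MvPolynomial

variable {k σ : Type*} [CommRing k]

lemma finrank_restrictTotalDegree_le [StrongRankCondition k] [Finite σ] (m : ℕ) :
    Module.finrank k (restrictTotalDegree σ k m) ≤ (m + 1) ^ Nat.card σ := by
  classical
  have := Fintype.ofFinite σ
  let exponents : Set (σ →₀ ℕ) := {n | (n.sum fun _ e => e) ≤ m}
  have apply_le (n : exponents) (i : σ) : n.1 i < m + 1 := by
    refine Nat.lt_succ_of_le (le_trans ?_ n.2)
    rw [Finsupp.sum_fintype _ _ fun _ => rfl]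
    exact Finset.single_le_sum (fun _ _ => Nat.zero_le _) (Finset.mem_univ i)
  have toFun_injective :
      Function.Injective fun (n : exponents) (i : σ) => (⟨n.1 i, apply_le n i⟩ : Fin (m + 1)) :=
    fun a b h => Subtype.ext <| Finsupp.ext fun i => congrArg Fin.val (congrFun h i)
  have := Finite.of_injective _ toFun_injective
  have := Fintype.ofFinite exponents
  rw [restrictTotalDegree, Module.finrank_eq_card_basis (basisRestrictSupport k exponents)]
  simpa using Fintype.card_le_of_injective _ toFun_injective

lemma totalDegree_coeff_prod_le {ι : Type*} (t : Finset ι)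
    {p : ι → Polynomial (MvPolynomial σ k)} {e : ℕ}
    (hp : ∀ i l, ((p i).coeff l).totalDegree ≤ e) (l : ℕ) :
    ((∏ i ∈ t, p i).coeff l).totalDegree ≤ e * t.card := by
  classical
  induction t using Finset.induction_on generalizing l with
  | empty => by_cases h : l = 0 <;> simp [Polynomial.coeff_one, h]
  | insert a t ha ih =>
    rw [Finset.prod_insert ha, Polynomial.coeff_mul, Finset.card_insert_of_notMem ha]
    refine totalDegree_finsetSum_le fun x _ => (totalDegree_mul _ _).trans ?_
    rw [mul_add, mul_one, add_comm]
    exact add_le_add (ih _) (hp a _)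

variable {ι : Type*} [Fintype ι] [DecidableEq ι]

lemma totalDegree_coeff_charmatrix_le (M : Matrix ι ι (MvPolynomial σ k)) {e : ℕ}
    (hM : ∀ i j, (M i j).totalDegree ≤ e) (i j : ι) (l : ℕ) :
    ((M.charmatrix i j).coeff l).totalDegree ≤ e := by
  rw [Matrix.charmatrix_apply, Polynomial.coeff_sub, Polynomial.coeff_C, Matrix.diagonal_apply]
  refine (totalDegree_sub _ _).trans (max_le ?_ ?_)
  · split_ifs
    · by_cases h : l = 1 <;> simp [Polynomial.coeff_X, h, eq_comm]
    · simp
  · split_ifs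
    · exact hM _ _
    · simp

lemma totalDegree_coeff_charpoly_le (M : Matrix ι ι (MvPolynomial σ k)) {e : ℕ}
    (hM : ∀ i j, (M i j).totalDegree ≤ e) (l : ℕ) :
    (M.charpoly.coeff l).totalDegree ≤ e * Fintype.card ι := by
  rw [Matrix.charpoly, Matrix.det_apply, Polynomial.finsetSum_coeff]
  refine totalDegree_finsetSum_le fun σ _ => ?_
  have hprod := totalDegree_coeff_prod_le Finset.univ
    (fun i => totalDegree_coeff_charmatrix_le M hM (σ i) i) l
  rw [Polynomial.coeff_smul]
  rcases Int.units_eq_one_or (Equiv.Perm.sign σ) with h | h <;> simpa [h] using hprod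

end TotalDegree

section MultiplierFiltration

open MvPolynomial

variable {k B σ ι : Type*} [CommRing k] [CommRing B] [Algebra k B] [Algebra (MvPolynomial σ k) B]
  [IsScalarTower k (MvPolynomial σ k) B] [Fintype ι] [DecidableEq ι]

variable (k σ) in
/-- The elements of `B` whose multiplication is represented, on the generators `ω` of `B` over a
polynomial ring, by a matrix with entries of total degree at most `e`. -/
def multiplierFiltration (ω : ι → B) (e : ℕ) : Submodule k B where
  carrier := {x | ∃ M : Matrix ι ι (MvPolynomial σ k),
    (∀ i j, (M i j).totalDegree ≤ e) ∧ M.Represents ω (Algebra.lmul _ B x)}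
  zero_mem' := ⟨0, by simp, by simpa using Matrix.Represents.zero⟩
  add_mem' := by
    rintro x y ⟨M, hM, hMx⟩ ⟨N, hN, hNy⟩
    refine ⟨M + N, fun i j => (totalDegree_add _ _).trans (max_le (hM i j) (hN i j)), ?_⟩
    rw [map_add]
    exact hMx.add hNy
  smul_mem' := by
    rintro c x ⟨M, hM, hMx⟩
    refine ⟨algebraMap k (MvPolynomial σ k) c • M, fun i j => ?_, ?_⟩
    · rw [algebraMap_smul]
      exact (totalDegree_smul_le _ _).trans (hM i j)
    · rw [← algebraMap_smul (MvPolynomial σ k) c x, map_smul]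
      exact hMx.smul _

variable {ω : ι → B}

lemma one_mem_multiplierFiltration : (1 : B) ∈ multiplierFiltration k σ ω 0 :=
  ⟨1, fun i j => by by_cases h : i = j <;> simp [Matrix.one_apply, h], by
    rw [map_one]; exact Matrix.Represents.one⟩

lemma mul_mem_multiplierFiltration {x y : B} {e e' : ℕ} (hx : x ∈ multiplierFiltration k σ ω e)
    (hy : y ∈ multiplierFiltration k σ ω e') : x * y ∈ multiplierFiltration k σ ω (e + e') := by
  obtain ⟨M, hM, hMx⟩ := hx
  obtain ⟨N, hN, hNy⟩ := hy
  refine ⟨M * N, fun i j => ?_, ?_⟩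
  · rw [Matrix.mul_apply]
    exact totalDegree_finsetSum_le fun l _ =>
      (totalDegree_mul _ _).trans (add_le_add (hM i l) (hN l j))
  · rw [map_mul]
    exact hMx.mul hNy

lemma multiplierFiltration_mono : Monotone (multiplierFiltration k σ ω) :=
  fun _ _ h _ ⟨M, hM, hMx⟩ => ⟨M, fun i j => (hM i j).trans h, hMx⟩

lemma exists_mem_multiplierFiltration
    (hω : Submodule.span (MvPolynomial σ k) (Set.range ω) = ⊤) (x : B) :
    ∃ e, x ∈ multiplierFiltration k σ ω e := by
  obtain ⟨M, hM⟩ := Matrix.isRepresentation.toEnd_surjective _ ω hω (Algebra.lmul _ B x)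
  let degree (i j : ι) := (M.1 i j).totalDegree
  refine ⟨Finset.univ.sup fun i => Finset.univ.sup (degree i), M.1, fun i j => ?_, ?_⟩
  · exact (Finset.le_sup (f := degree i) (Finset.mem_univ j)).trans
      (Finset.le_sup (f := fun i => Finset.univ.sup (degree i)) (Finset.mem_univ i))
  · rw [← hM]
    exact Matrix.isRepresentation.toEnd_represents _ ω hω M

lemma exists_pow_le_multiplierFiltration
    (hω : Submodule.span (MvPolynomial σ k) (Set.range ω) = ⊤) {W : Submodule k B} (hW : W.FG) :
    ∃ D, ∀ n, W ^ n ≤ multiplierFiltration k σ ω (D * n) := by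
  obtain ⟨w, rfl⟩ := hW
  choose e he using exists_mem_multiplierFiltration (k := k) hω
  have hspan : Submodule.span k w ≤ multiplierFiltration k σ ω (w.sup e) :=
    Submodule.span_le.mpr fun x hx => multiplierFiltration_mono (Finset.le_sup hx) (he x)
  refine ⟨w.sup e, fun n => ?_⟩
  induction n with
  | zero =>
    rw [pow_zero, Submodule.one_le]
    exact one_mem_multiplierFiltration
  | succ n ih =>
    rw [pow_succ, Submodule.mul_le]
    exact fun x hx y hy => mul_mem_multiplierFiltration (ih hx) (hspan hy)

lemma exists_linearCombination_eq_of_mem_multiplierFiltration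
    (hω : Submodule.span (MvPolynomial σ k) (Set.range ω) = ⊤) :
    ∃ D, ∀ e, ∀ x ∈ multiplierFiltration k σ ω e, ∃ a : ι → MvPolynomial σ k,
      (∀ i, (a i).totalDegree ≤ e + D) ∧ Fintype.linearCombination _ ω a = x := by
  obtain ⟨c, hc⟩ := (Submodule.mem_span_range_iff_exists_fun _).mp
    (hω ▸ Submodule.mem_top : (1 : B) ∈ Submodule.span (MvPolynomial σ k) (Set.range ω))
  refine ⟨Finset.univ.sup fun i => (c i).totalDegree, ?_⟩
  rintro e x ⟨M, hM, hMx⟩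
  refine ⟨M.mulVec c, fun i => ?_, ?_⟩
  · refine totalDegree_finsetSum_le fun j _ => (totalDegree_mul _ _).trans ?_
    exact add_le_add (hM i j)
      (Finset.le_sup (f := fun i => (c i).totalDegree) (Finset.mem_univ j))
  · rw [hMx.congr_fun c, Fintype.linearCombination_apply, hc]
    exact mul_one x

end MultiplierFiltration

section CayleyHamilton

lemma aeval_charpoly_eq_zero_of_represents {R M ι : Type*} [CommRing R] [AddCommGroup M]
    [Module R M] [Fintype ι] [DecidableEq ι] {b : ι → M}
    (hb : Submodule.span R (Set.range b) = ⊤) {A : Matrix ι ι R} {f : Module.End R M}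
    (hA : A.Represents b f) : Polynomial.aeval f A.charpoly = 0 := by
  let A' : Matrix.isRepresentation R b := ⟨A, f, hA⟩
  have hA' : Polynomial.aeval A' A.charpoly = 0 := Subtype.ext <| by
    rw [← Subalgebra.coe_val, ← Polynomial.aeval_algHom_apply]
    exact Matrix.aeval_self_charpoly A
  rw [← Matrix.isRepresentation.eq_toEnd_of_represents R b hb A' hA, Polynomial.aeval_algHom_apply,
    hA', map_zero]

lemma exists_dvd_algebraMap_coeff {R B : Type*} [CommRing R] [CommRing B] [IsDomain B]
    [Algebra R B] {p : Polynomial R} (hp : p ≠ 0) {x : B} (hx : x ≠ 0)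
    (hpx : Polynomial.aeval x p = 0) :
    ∃ l, p.coeff l ≠ 0 ∧ x ∣ algebraMap R B (p.coeff l) := by
  obtain ⟨q, hq, hq0⟩ := Polynomial.exists_eq_pow_rootMultiplicity_mul_and_not_dvd p hp 0
  rw [Polynomial.C_0, sub_zero] at hq hq0
  set l := Polynomial.rootMultiplicity 0 p
  have hcoeff : p.coeff l = q.coeff 0 := by
    rw [hq]; simpa using Polynomial.coeff_X_pow_mul q l 0
  have hqx : Polynomial.aeval x q = 0 := by
    rw [hq, map_mul, map_pow, Polynomial.aeval_X] at hpx
    exact (mul_eq_zero.mp hpx).resolve_left (pow_ne_zero _ hx)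
  rw [← Polynomial.divX_mul_X_add q, map_add, map_mul, Polynomial.aeval_X,
    Polynomial.aeval_C] at hqx
  exact ⟨l, hcoeff ▸ fun h => hq0 (Polynomial.X_dvd_iff.mpr h),
    -(Polynomial.aeval x q.divX), by rw [hcoeff]; linear_combination hqx⟩

end CayleyHamilton

section FinitePolynomial

open MvPolynomial

variable {k B σ : Type*} [CommRing B]

lemma exists_dvd_algebraMap_of_mem_pow [CommRing k] [IsDomain B] [Algebra k B]
    [Algebra (MvPolynomial σ k) B] [IsScalarTower k (MvPolynomial σ k) B]
    [Module.Finite (MvPolynomial σ k) B] {W : Submodule k B} (hW : W.FG) :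
    ∃ C, ∀ n, ∀ x ∈ W ^ n, x ≠ 0 → ∃ a : MvPolynomial σ k, a ≠ 0 ∧
      a.totalDegree ≤ C * n ∧ x ∣ algebraMap _ B a := by
  have : Nontrivial k := (algebraMap k B).domain_nontrivial
  obtain ⟨r, ω, hω⟩ := Module.Finite.exists_fin (R := MvPolynomial σ k) (M := B)
  obtain ⟨D, hD⟩ := exists_pow_le_multiplierFiltration hω hW
  refine ⟨D * r, fun n x hx hx0 => ?_⟩
  obtain ⟨M, hM, hMx⟩ := hD n hx
  have hroot : Polynomial.aeval x M.charpoly = 0 :=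
    Algebra.lmul_injective (R := MvPolynomial σ k) <| by
      rw [← Polynomial.aeval_algHom_apply, aeval_charpoly_eq_zero_of_represents hω hMx, map_zero]
  obtain ⟨l, hl, hdvd⟩ := exists_dvd_algebraMap_coeff M.charpoly_monic.ne_zero hx0 hroot
  refine ⟨_, hl, (totalDegree_coeff_charpoly_le M hM l).trans (le_of_eq ?_), hdvd⟩
  rw [Fintype.card_fin, mul_right_comm]

lemma hasPolynomialGrowth_finrank_pow [Field k] [Algebra k B]
    [Algebra (MvPolynomial σ k) B] [IsScalarTower k (MvPolynomial σ k) B]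
    [Module.Finite (MvPolynomial σ k) B] [Finite σ] {W : Submodule k B} (hW : W.FG) :
    HasPolynomialGrowth (fun n => Module.finrank k (W ^ n : Submodule k B)) (Nat.card σ) := by
  obtain ⟨r, ω, hω⟩ := Module.Finite.exists_fin (R := MvPolynomial σ k) (M := B)
  obtain ⟨D, hD⟩ := exists_pow_le_multiplierFiltration hω hW
  obtain ⟨D₀, hD₀⟩ := exists_linearCombination_eq_of_mem_multiplierFiltration (k := k) hω
  let combination (m : ℕ) : (Fin r → restrictTotalDegree σ k m) →ₗ[k] B :=
    (Fintype.linearCombination _ ω).restrictScalars k ∘ₗ (Submodule.subtype _).compLeft (Fin r)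
  have hrange (n : ℕ) : W ^ n ≤ LinearMap.range (combination (D * n + D₀)) := by
    intro x hx
    obtain ⟨a, ha, rfl⟩ := hD₀ _ x (hD n hx)
    exact ⟨fun i => ⟨a i, (mem_restrictTotalDegree ..).mpr (ha i)⟩, rfl⟩
  have hgrowth : HasPolynomialGrowth (fun m => r * (m + 1) ^ Nat.card σ) (Nat.card σ) :=
    ⟨r, fun _ => le_rfl⟩
  refine (hgrowth.comp_affine D D₀).of_le fun n => ?_
  calc Module.finrank k (W ^ n : Submodule k B)
      ≤ Module.finrank k (LinearMap.range (combination (D * n + D₀))) :=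
        Submodule.finrank_mono (hrange n)
    _ ≤ r * Module.finrank k (restrictTotalDegree σ k (D * n + D₀)) := by
        simpa [Module.finrank_pi_fintype] using
          LinearMap.finrank_range_le (combination (D * n + D₀))
    _ ≤ _ := Nat.mul_le_mul_left r (finrank_restrictTotalDegree_le _)

end FinitePolynomial

section Conductor

open MvPolynomial

lemma exists_free_submodule_forall_smul_mem (R M : Type*) [CommRing R] [IsDomain R]
    [AddCommGroup M] [Module R M] [Module.Finite R M] :
    ∃ N : Submodule R M, Module.Free R N ∧ ∃ c : R, c ≠ 0 ∧ ∀ x : M, c • x ∈ N := by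
  obtain ⟨T, hT, hTmax⟩ := exists_maximal_linearIndepOn R (id : M → M)
  let N : Submodule R M := Submodule.span R (id '' T)
  have hfree : Module.Free R N := .of_basis <| Set.image_eq_range id T ▸ Module.Basis.span hT
  have htorsion : Module.IsTorsion R (M ⧸ N) := by
    intro y
    obtain ⟨x, rfl⟩ := N.mkQ_surjective y
    have mk_smul_eq_zero {a : R} (ha : a • x ∈ N) : a • N.mkQ x = 0 := by
      rwa [← map_smul, Submodule.mkQ_apply, Submodule.Quotient.mk_eq_zero]
    by_cases hx : x ∈ T
    · exact ⟨1, mk_smul_eq_zero ((one_smul R x).symm ▸ Submodule.subset_span ⟨x, hx, rfl⟩)⟩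
    · obtain ⟨a, ha, hax⟩ := hTmax x hx
      exact ⟨⟨a, mem_nonZeroDivisors_of_ne_zero ha⟩, mk_smul_eq_zero hax⟩
  obtain ⟨c, hc, hc0⟩ := Submodule.annihilator_top_inter_nonZeroDivisors htorsion
  refine ⟨N, hfree, c, nonZeroDivisors.ne_zero hc0, fun x => ?_⟩
  have hcx : c • N.mkQ x = 0 := Submodule.mem_annihilator.mp hc _ Submodule.mem_top
  rwa [← map_smul, Submodule.mkQ_apply, Submodule.Quotient.mk_eq_zero] at hcx

lemma exists_eq_smul_of_smul_eq_smul {R N : Type*} [CommRing R] [AddCommGroup N] [Module R N]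
    [Module.Free R N] {p q : R} (hpq : ∀ a b, q * a = p * b → p ∣ a) {α β : N}
    (h : q • α = p • β) : ∃ γ, α = p • γ := by
  let b := Module.Free.chooseBasis R N
  have hdvd (i) : p ∣ b.repr α i := hpq _ (b.repr β i) <| by
    simpa using DFunLike.congr_fun (congrArg b.repr h) i
  choose γ hγ using hdvd
  refine ⟨(b.repr α).sum fun i _ => γ i • b i, ?_⟩
  conv_lhs => rw [← b.linearCombination_repr α]
  rw [Finsupp.linearCombination_apply, Finsupp.smul_sum]
  exact Finsupp.sum_congr fun i _ => by rw [hγ i, smul_smul]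

lemma X_pow_dvd_of_X_pow_mul_eq {R σ : Type*} [CommRing R] [IsDomain R] {i j : σ} (hij : i ≠ j)
    {a b : MvPolynomial σ R} {m n : ℕ} (h : X j ^ n * a = X i ^ m * b) : X i ^ m ∣ a := by
  refine Prime.pow_dvd_of_dvd_mul_left X_prime m (fun hd => ?_) ⟨b, h⟩
  exact hij (X_dvd_X.mp ((X_prime (R := R)).dvd_of_dvd_pow hd))

/-- `p, q` is a regular sequence on a free `Z`-module containing `c • S`, so that the elements of
`Ω` carried into `S` by powers of both `p` and `q` are carried into `S` by `c` alone. -/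
lemma exists_conductor (Z : Type*) {S Ω : Type*} [CommRing Z] [IsDomain Z] [CommRing S]
    [Algebra Z S] [Module.Finite Z S] [CommRing Ω] [IsDomain Ω] [Algebra S Ω] [FaithfulSMul S Ω]
    [Algebra Z Ω] [IsScalarTower Z S Ω] [FaithfulSMul Z Ω] :
    ∃ c : Z, c ≠ 0 ∧ ∀ p q : Z, p ≠ 0 → (∀ a b, q * a = p * b → p ∣ a) → ∀ x : Ω,
      p • x ∈ (algebraMap S Ω).range → q • x ∈ (algebraMap S Ω).range →
      c • x ∈ (algebraMap S Ω).range := by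
  have algebraMap_smul_eq (a : Z) (t : S) : algebraMap S Ω (a • t) = a • algebraMap S Ω t :=
    (IsScalarTower.toAlgHom Z S Ω).map_smul_of_tower a t
  obtain ⟨N, hN, c, hc0, hc⟩ := exists_free_submodule_forall_smul_mem Z S
  refine ⟨c, hc0, fun p q hp hpq x ⟨t, ht⟩ ⟨u, hu⟩ => ?_⟩
  have hqp : q • t = p • u := FaithfulSMul.algebraMap_injective S Ω <| by
    simp only [algebraMap_smul_eq, ht, hu, smul_comm p q]
  obtain ⟨γ, hγ⟩ := exists_eq_smul_of_smul_eq_smul hpq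
    (α := (⟨c • t, hc t⟩ : N)) (β := ⟨c • u, hc u⟩) <| Subtype.ext <| by
      simp only [SetLike.mk_smul_mk, smul_comm _ c, hqp]
  refine ⟨γ, smul_right_injective Ω hp ?_⟩
  calc p • algebraMap S Ω γ = algebraMap S Ω (c • t) := by
        rw [← algebraMap_smul_eq, ← Submodule.coe_smul, ← hγ]
    _ = p • c • x := by rw [algebraMap_smul_eq, ht, smul_comm]

end Conductor

section NoetherNormalization

open MvPolynomial

lemma trdeg_eq_of_finite_injective {k S : Type*} [Field k] [CommRing S] [IsDomain S]
    [Algebra k S] {s : ℕ} (g : MvPolynomial (Fin s) k →ₐ[k] S) (hg : Function.Injective g)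
    (hfin : g.Finite) : Algebra.trdeg k S = s := by
  let := g.toRingHom.toAlgebra
  have : Module.Finite (MvPolynomial (Fin s) k) S := hfin
  have : IsScalarTower k (MvPolynomial (Fin s) k) S :=
    .of_algebraMap_eq fun r => (g.commutes r).symm
  have : FaithfulSMul (MvPolynomial (Fin s) k) S :=
    (faithfulSMul_iff_algebraMap_injective _ _).mpr hg
  have := lift_trdeg_add_eq k (MvPolynomial (Fin s) k) S
  rw [MvPolynomial.trdeg_of_isDomain, trdeg_eq_zero] at this
  simpa using this.symm

/-- The variables are translated into `J`. -/
lemma exists_finite_injective_forall_X_mem {k S : Type*} [Field k] [CommRing S] [Nontrivial S]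
    [Algebra k S] [Algebra.FiniteType k S] (J : Ideal S)
    (hJ : ∀ x, ∃ r : k, x - algebraMap k S r ∈ J) :
    ∃ (s : ℕ) (g : MvPolynomial (Fin s) k →ₐ[k] S),
      Function.Injective g ∧ g.Finite ∧ ∀ i, g (X i) ∈ J := by
  obtain ⟨s, g, hg, hfin⟩ := exists_finite_inj_algHom_of_fg k S
  choose ρ hρ using hJ
  let r (i : Fin s) : k := ρ (g (X i))
  let translation : MvPolynomial (Fin s) k ≃ₐ[k] MvPolynomial (Fin s) k :=
    AlgEquiv.ofAlgHom (aeval fun i => X i - C (r i)) (aeval fun i => X i + C (r i))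
      (by ext; simp) (by ext; simp)
  refine ⟨s, g.comp translation, hg.comp translation.injective,
    hfin.comp (.of_surjective _ translation.surjective), fun i => ?_⟩
  simpa [translation, r, ← MvPolynomial.algebraMap_eq] using hρ (g (X i))

lemma exists_sub_algebraMap_mem_span {k S : Type*} [CommRing k] [CommRing S] [Algebra k S]
    {s : Set S} (hs : Algebra.adjoin k s = ⊤) (x : S) :
    ∃ r : k, x - algebraMap k S r ∈ Ideal.span s := by
  have hle : Algebra.adjoin k s ≤
      (⊥ : Subalgebra k (S ⧸ Ideal.span s)).comap (Ideal.Quotient.mkₐ k (Ideal.span s)) :=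
    Algebra.adjoin_le fun z hz =>
      ⟨0, by simpa using (Ideal.Quotient.eq_zero_iff_mem.mpr (Ideal.subset_span hz)).symm⟩
  obtain ⟨r, hr⟩ := Algebra.mem_bot.mp (hle (hs ▸ Algebra.mem_top : x ∈ Algebra.adjoin k s))
  exact ⟨r, Ideal.Quotient.eq.mp hr.symm⟩

lemma exists_pow_smul_mem_range_of_mem_span {S Ω : Type*} [CommRing S] [CommRing Ω] [Algebra S Ω]
    {s : Set S} {x : Ω} (hx : ∀ z ∈ s, ∃ m : ℕ, z ^ m • x ∈ (algebraMap S Ω).range) {z : S}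
    (hz : z ∈ Ideal.span s) : ∃ m : ℕ, z ^ m • x ∈ (algebraMap S Ω).range := by
  let carriers : Ideal S :=
    (LinearMap.range (Algebra.linearMap S Ω)).comap (LinearMap.toSpanSingleton S Ω x)
  have hradical : Ideal.span s ≤ carriers.radical := Ideal.span_le.mpr hx
  exact hradical hz

lemma exists_common_conductor {k S Ω : Type*} [Field k] [CommRing S] [IsDomain S] [Algebra k S]
    [CommRing Ω] [IsDomain Ω] [Algebra S Ω] [FaithfulSMul S Ω] {s : Set S} (hsfin : s.Finite)
    (hs : Algebra.adjoin k s = ⊤) (htrdeg : 2 ≤ Algebra.trdeg k S) :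
    ∃ c : S, c ≠ 0 ∧ ∀ x : Ω, (∀ z ∈ s, ∃ m : ℕ, z ^ m • x ∈ (algebraMap S Ω).range) →
      c • x ∈ (algebraMap S Ω).range := by
  have : Algebra.FiniteType k S := ⟨Subalgebra.fg_def.mpr ⟨s, hsfin, hs⟩⟩
  obtain ⟨d, g, hg, hfin, hgs⟩ :=
    exists_finite_injective_forall_X_mem (Ideal.span s) (exists_sub_algebraMap_mem_span hs)
  have hd : 2 ≤ d := by
    rw [trdeg_eq_of_finite_injective g hg hfin] at htrdeg
    exact_mod_cast htrdeg
  let := g.toRingHom.toAlgebra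
  let := ((algebraMap S Ω).comp g.toRingHom).toAlgebra
  have : IsScalarTower (MvPolynomial (Fin d) k) S Ω := .of_algebraMap_eq fun _ => rfl
  have : Module.Finite (MvPolynomial (Fin d) k) S := hfin
  have : FaithfulSMul (MvPolynomial (Fin d) k) Ω := (faithfulSMul_iff_algebraMap_injective _ _).mpr
    ((FaithfulSMul.algebraMap_injective S Ω).comp hg)
  have smul_eq (a : MvPolynomial (Fin d) k) (x : Ω) : a • x = g a • x :=
    (algebraMap_smul S a x).symm
  obtain ⟨c, hc0, hc⟩ := exists_conductor (MvPolynomial (Fin d) k) (S := S) (Ω := Ω)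
  simp only [smul_eq] at hc
  refine ⟨g c, (map_ne_zero_iff g hg).mpr hc0, fun x hx => ?_⟩
  obtain ⟨m, hm⟩ := exists_pow_smul_mem_range_of_mem_span hx (hgs ⟨0, by lia⟩)
  obtain ⟨n, hn⟩ := exists_pow_smul_mem_range_of_mem_span hx (hgs ⟨1, by lia⟩)
  rw [← map_pow] at hm hn
  exact hc _ _ (pow_ne_zero m (X_ne_zero _))
    (fun _ _ => X_pow_dvd_of_X_pow_mul_eq (by simp)) x hm hn

end NoetherNormalization

section Cone

open Polynomial

variable {k K ι : Type*}

/-- The homogeneous coordinate ring of the projective variety with homogeneous coordinates `y` in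
its function field `K`. Its part of degree `n` is the `n`-th power of the span of `y`, embedded in
`K[X]` as coefficients of `X ^ n`. -/
noncomputable def coneAlgebra (k : Type*) {K ι : Type*} [CommSemiring k] [CommSemiring K]
    [Algebra k K] (y : ι → K) : Subalgebra k K[X] :=
  Algebra.adjoin k (Set.range fun i => C (y i) * X)

lemma coeff_mem_span_pow_of_mem_coneAlgebra [CommSemiring k] [CommSemiring K] [Algebra k K]
    {y : ι → K} {p : K[X]} (hp : p ∈ coneAlgebra k y) (n : ℕ) :
    p.coeff n ∈ Submodule.span k (Set.range y) ^ n := by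
  induction hp using Algebra.adjoin_induction generalizing n with
  | mem p hp =>
    obtain ⟨i, rfl⟩ := hp
    by_cases h : n = 1
    · simpa [h] using Submodule.subset_span (Set.mem_range_self i)
    · simp [coeff_X, Ne.symm h]
  | algebraMap r =>
    by_cases h : n = 0
    · simp [h]
    · simp [coeff_C, h]
  | add p q _ _ hp hq => exact coeff_add p q n ▸ add_mem (hp n) (hq n)
  | mul p q _ _ hp hq =>
    rw [coeff_mul]
    refine Submodule.sum_mem _ fun x hx => ?_
    rw [← Finset.HasAntidiagonal.mem_antidiagonal.mp hx, pow_add]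
    exact Submodule.mul_mem_mul (hp _) (hq _)

lemma monomial_mem_coneAlgebra_of_mem_span_pow [CommSemiring k] [CommSemiring K] [Algebra k K]
    {y : ι → K} {n : ℕ} {x : K} (hx : x ∈ Submodule.span k (Set.range y) ^ n) :
    monomial n x ∈ coneAlgebra k y := by
  let degreePart (n : ℕ) : Submodule k K :=
    (Subalgebra.toSubmodule (coneAlgebra k y)).comap ((monomial n).restrictScalars k)
  have hspan : Submodule.span k (Set.range y) ≤ degreePart 1 := Submodule.span_le.mpr <| by
    rintro _ ⟨i, rfl⟩
    exact Algebra.subset_adjoin ⟨i, C_mul_X_eq_monomial⟩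
  have hpow (n : ℕ) : Submodule.span k (Set.range y) ^ n ≤ degreePart n := by
    induction n with
    | zero => exact Submodule.one_le.mpr (one_mem (coneAlgebra k y))
    | succ n ih =>
      rw [pow_succ]
      refine Submodule.mul_le.mpr fun a ha b hb => ?_
      have hab : monomial n a * monomial 1 b ∈ coneAlgebra k y := mul_mem (ih ha) (hspan hb)
      rwa [monomial_mul_monomial] at hab
  exact hpow n hx

lemma algebraicIndependent_sumElim_mul {R A : Type*} [CommRing R] [CommRing A] [IsDomain A]
    [Algebra R A] {u t : A}
    (h : AlgebraicIndependent R (Sum.elim (fun _ : Unit => t) fun _ : Unit => u)) :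
    AlgebraicIndependent R (Sum.elim (fun _ : Unit => u * t) fun _ : Unit => u) := by
  obtain ⟨hu, ht⟩ := AlgebraicIndependent.sumElim_iff.mp h
  refine hu.sumElim (algebraicIndependent_unique_type_iff.mpr fun hut => ?_)
  have := (algebraMap R A).domain_nontrivial
  let u' : Algebra.adjoin R (Set.range fun _ : Unit => u) := ⟨u, Algebra.subset_adjoin ⟨(), rfl⟩⟩
  exact algebraicIndependent_unique_type_iff.mp ht
    (.of_mul (mem_nonZeroDivisors_of_ne_zero (hu.ne_zero ())) (isAlgebraic_algebraMap u') hut)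

lemma algebraicIndependent_sumElim_C_mul_X [Field k] [Field K] [Algebra k K] {a b : K} (ha : a ≠ 0)
    (hab : Transcendental k (b / a)) : AlgebraicIndependent k
      (Sum.elim (fun _ : Unit => (C b * X : K[X])) fun _ : Unit => C a * X) := by
  have hX : Transcendental K (C a * X : K[X]) :=
    Polynomial.transcendental _ (by simp [ha]) (by simp [ha])
  have hind : AlgebraicIndependent k
      (Sum.elim (fun _ : Unit => (C a * X : K[X])) (algebraMap K K[X] ∘ fun _ : Unit => b / a)) :=
    .sumElim_comp (algebraicIndependent_unique_type_iff.mpr hab)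
      (algebraicIndependent_unique_type_iff.mpr hX)
  have hba : C a * X * C (b / a) = (C b * X : K[X]) := by
    rw [mul_right_comm, ← C_mul, mul_div_cancel₀ b ha]
  rw [← hba]
  refine algebraicIndependent_sumElim_mul ?_
  convert! hind.comp Sum.swap (Equiv.sumComm _ _).injective using 1
  ext (_ | _) <;> rfl

lemma two_le_trdeg_coneAlgebra [Field k] [Field K] [Algebra k K] {y : ι → K} {i j : ι}
    (hi : y i ≠ 0) (ht : Transcendental k (y j / y i)) :
    2 ≤ Algebra.trdeg k (coneAlgebra k y) := by
  let Y (i : ι) : coneAlgebra k y := ⟨C (y i) * X, Algebra.subset_adjoin ⟨i, rfl⟩⟩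
  have hind : AlgebraicIndependent k (Sum.elim (fun _ : Unit => Y j) fun _ : Unit => Y i) := by
    refine .of_comp (coneAlgebra k y).val ?_
    convert! algebraicIndependent_sumElim_C_mul_X hi ht using 1
    ext (_ | _) <;> rfl
  have := hind.lift_cardinalMk_le_trdeg
  simpa [one_add_one_eq_two] using this

theorem exists_mul_mem_span_pow_of_saturated [Field k] [Field K] [Algebra k K] [Finite ι]
    {y : ι → K} {i j : ι} (hi : y i ≠ 0) (ht : Transcendental k (y j / y i)) :
    ∃ h : K, h ≠ 0 ∧ ∃ m : ℕ, ∀ (n : ℕ) (f : K),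
      (∀ i, ∃ l, y i ^ l * f ∈ Submodule.span k (Set.range y) ^ (n + l)) →
      h * f ∈ Submodule.span k (Set.range y) ^ (n + m) := by
  obtain ⟨c, hc0, hc⟩ := exists_common_conductor (k := k) (S := coneAlgebra k y) (Ω := K[X])
    ((Set.finite_range _).preimage Subtype.val_injective.injOn) Algebra.adjoin_adjoin_coe_preimage
    (two_le_trdeg_coneAlgebra hi ht)
  obtain ⟨m, hm⟩ : ∃ m, (c : K[X]).coeff m ≠ 0 := by
    by_contra! h
    exact hc0 (Subtype.ext (Polynomial.ext h))
  refine ⟨(c : K[X]).coeff m, hm, m, fun n f hf => ?_⟩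
  obtain ⟨b, hb⟩ := hc (monomial n f) <| by
    rintro ⟨_, hz⟩ ⟨i, rfl⟩
    obtain ⟨l, hl⟩ := hf i
    refine ⟨l, ⟨_, monomial_mem_coneAlgebra_of_mem_span_pow hl⟩, ?_⟩
    change monomial (n + l) (y i ^ l * f) = (C (y i) * X) ^ l * monomial n f
    rw [C_mul_X_eq_monomial, monomial_pow, monomial_mul_monomial, one_mul, add_comm]
  have hbc : (b : K[X]) = c * monomial n f := hb
  have hcoeff := coeff_mem_span_pow_of_mem_coneAlgebra b.2 (n + m)
  rwa [hbc, add_comm, coeff_mul_monomial, add_comm] at hcoeff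

end Cone

section FinrankOfMulMem

variable {k K : Type*} [Field k] [CommRing K] [IsDomain K] [Algebra k K] {V W : Submodule k K}
  {a : K}

lemma injective_mulLeft_restrict (ha : a ≠ 0) (h : ∀ f ∈ V, a * f ∈ W) :
    Function.Injective ((LinearMap.mulLeft k a).restrict h) :=
  fun _ _ hfg => Subtype.ext (mul_left_cancel₀ ha (congrArg Subtype.val hfg))

lemma finite_of_mul_mem [Module.Finite k W] (ha : a ≠ 0) (h : ∀ f ∈ V, a * f ∈ W) :
    Module.Finite k V :=
  .of_injective _ (injective_mulLeft_restrict ha h)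

lemma finrank_le_of_mul_mem [Module.Finite k W] (ha : a ≠ 0) (h : ∀ f ∈ V, a * f ∈ W) :
    Module.finrank k V ≤ Module.finrank k W :=
  LinearMap.finrank_le_finrank_of_injective (injective_mulLeft_restrict ha h)

end FinrankOfMulMem

section CoordinateSystem

variable {k K ι : Type*}

open Pointwise

/-- The coordinate ring of the chart `y i ≠ 0` of the projective variety with homogeneous
coordinates `y`, as a subring of its function field `K`. -/
noncomputable def chartAlgebra (k : Type*) {K ι : Type*} [CommSemiring k] [Semifield K]
    [Algebra k K] (y : ι → K) (i : ι) : Subalgebra k K :=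
  Algebra.adjoin k (Set.range fun j => y j / y i)

/-- The linear forms on the chart `y i ≠ 0`: their powers exhaust the coordinate ring and measure
the degree of its elements. -/
noncomputable def chartForms (k : Type*) {K ι : Type*} [CommSemiring k] [Semifield K] [Algebra k K]
    (y : ι → K) (i : ι) : Submodule k (chartAlgebra k y i) :=
  Submodule.span k (Set.range fun j => ⟨y j / y i, Algebra.subset_adjoin ⟨j, rfl⟩⟩)

/-- The family `y` is the family of nonzero homogeneous coordinates on a projective variety of
function field `K`: every chart `y i ≠ 0` is nonempty and has function field `K`. -/
structure IsCoordinateSystem (k : Type*) {K ι : Type*} [CommSemiring k] [Field K] [Algebra k K]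
    (y : ι → K) : Prop where
  ne_zero : ∀ i, y i ≠ 0
  isFractionRing : ∀ i, IsFractionRing (chartAlgebra k y i) K

/-- A sequence of subspaces of `K` whose denominators on each chart grow at most linearly: for
instance, the sections of the multiples of a divisor. -/
def HasBoundedPoles (k : Type*) {K ι : Type*} [CommSemiring k] [Semifield K] [Algebra k K]
    (y : ι → K) (V : ℕ → Submodule k K) : Prop :=
  ∀ i, ∃ b ∈ chartAlgebra k y i, b ≠ 0 ∧ ∀ n, ∀ f ∈ V n, b ^ n * f ∈ chartAlgebra k y i

section Semifield

variable [CommSemiring k] [Semifield K] [Algebra k K] {y : ι → K} {i : ι}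

lemma chartForms_fg [Finite ι] (y : ι → K) (i : ι) : (chartForms k y i).FG :=
  Submodule.fg_span (Set.finite_range _)

lemma pow_mem_span_range_pow (n : ℕ) : y i ^ n ∈ Submodule.span k (Set.range y) ^ n :=
  Submodule.pow_mem_pow _ (Submodule.subset_span (Set.mem_range_self i)) n

lemma span_range_pow_eq_smul_map_chartForms_pow (hi : y i ≠ 0) (n : ℕ) :
    Submodule.span k (Set.range y) ^ n =
      y i ^ n • (chartForms k y i ^ n).map (chartAlgebra k y i).val.toLinearMap := by
  have hspan : Submodule.span k (Set.range y) =
      Submodule.span k {y i} * (chartForms k y i).map (chartAlgebra k y i).val.toLinearMap := by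
    rw [chartForms, Submodule.map_span, Submodule.span_mul_span, ← Set.range_comp,
      Set.singleton_mul, ← Set.range_comp]
    congr 2
    funext j
    exact (mul_div_cancel₀ _ hi).symm
  rw [hspan, mul_pow, Submodule.map_pow, Submodule.span_pow, Set.singleton_pow,
    Submodule.span_singleton_mul]

lemma exists_pow_mul_mem_span_range_pow (hi : y i ≠ 0) {b : K} (hb : b ∈ chartAlgebra k y i) :
    ∃ m, y i ^ m * b ∈ Submodule.span k (Set.range y) ^ m := by
  induction hb using Algebra.adjoin_induction with
  | mem x hx =>
    obtain ⟨j, rfl⟩ := hx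
    refine ⟨1, ?_⟩
    rw [pow_one, pow_one, mul_div_cancel₀ _ hi]
    exact Submodule.subset_span ⟨j, rfl⟩
  | algebraMap r => exact ⟨0, by simp⟩
  | add x z _ _ hx hz =>
    obtain ⟨m, hm⟩ := hx
    obtain ⟨n, hn⟩ := hz
    refine ⟨m + n, ?_⟩
    rw [show y i ^ (m + n) * (x + z) = y i ^ m * x * y i ^ n + y i ^ m * (y i ^ n * z) by ring,
      pow_add]
    exact add_mem (Submodule.mul_mem_mul hm (pow_mem_span_range_pow n))
      (Submodule.mul_mem_mul (pow_mem_span_range_pow m) hn)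
  | mul x z _ _ hx hz =>
    obtain ⟨m, hm⟩ := hx
    obtain ⟨n, hn⟩ := hz
    refine ⟨m + n, ?_⟩
    rw [show y i ^ (m + n) * (x * z) = y i ^ m * x * (y i ^ n * z) by ring, pow_add]
    exact Submodule.mul_mem_mul hm hn

end Semifield

variable [Field k] [Field K] [Algebra k K] {y : ι → K}

instance [Finite ι] (i : ι) : Algebra.FiniteType k (chartAlgebra k y i) :=
  (Subalgebra.fg_iff_finiteType _).mp (Subalgebra.fg_def.mpr ⟨_, Set.finite_range _, rfl⟩)

namespace IsCoordinateSystem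

lemma isAlgebraic (hy : IsCoordinateSystem k y) (i : ι) :
    Algebra.IsAlgebraic (chartAlgebra k y i) K :=
  have := hy.isFractionRing i
  IsLocalization.isAlgebraic K (nonZeroDivisors (chartAlgebra k y i))

lemma trdeg_chartAlgebra (hy : IsCoordinateSystem k y) (i : ι) :
    Algebra.trdeg k (chartAlgebra k y i) = Algebra.trdeg k K := by
  have := hy.isAlgebraic i
  rw [← trdeg_add_eq k (chartAlgebra k y i) (A := K), trdeg_eq_zero_iff.mpr this, add_zero]

lemma exists_transcendental (hy : IsCoordinateSystem k y) (h : Algebra.trdeg k K ≠ 0) (i : ι) :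
    ∃ j, Transcendental k (y j / y i) := by
  by_contra! hall
  have : Algebra.IsAlgebraic k (chartAlgebra k y i) := Subalgebra.isAlgebraic_iff _ |>.mp <|
    Algebra.isAlgebraic_adjoin_iff.mpr <| Set.forall_mem_range.mpr fun j => not_not.mp (hall j)
  exact h (hy.trdeg_chartAlgebra i ▸ trdeg_eq_zero)

variable [Finite ι]

lemma exists_noetherNormalization (hy : IsCoordinateSystem k y) (i : ι) {d : ℕ}
    (hd : Algebra.trdeg k K = d) :
    ∃ g : MvPolynomial (Fin d) k →ₐ[k] chartAlgebra k y i, Function.Injective g ∧ g.Finite := by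
  obtain ⟨s, g, hg, hfin⟩ := exists_finite_inj_algHom_of_fg k (chartAlgebra k y i)
  obtain rfl : d = s := by
    have := trdeg_eq_of_finite_injective g hg hfin
    rwa [hy.trdeg_chartAlgebra, hd, Nat.cast_inj] at this
  exact ⟨g, hg, hfin⟩

lemma hasPolynomialGrowth_finrank_span_range_pow [Nonempty ι] (hy : IsCoordinateSystem k y) {d : ℕ}
    (hd : Algebra.trdeg k K = d) :
    HasPolynomialGrowth
      (fun n => Module.finrank k (Submodule.span k (Set.range y) ^ n : Submodule k K)) d := by
  let i := Classical.arbitrary ι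
  obtain ⟨g, -, hfin⟩ := hy.exists_noetherNormalization i hd
  let := g.toRingHom.toAlgebra
  have : IsScalarTower k (MvPolynomial (Fin d) k) (chartAlgebra k y i) :=
    .of_algebraMap_eq fun c => (g.commutes c).symm
  have : Module.Finite (MvPolynomial (Fin d) k) (chartAlgebra k y i) := hfin
  have hgrowth := hasPolynomialGrowth_finrank_pow (σ := Fin d) (chartForms_fg (k := k) y i)
  rw [Nat.card_fin] at hgrowth
  refine hgrowth.of_le fun n => ?_
  have : Module.Finite k (chartForms k y i ^ n : Submodule k (chartAlgebra k y i)) :=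
    Module.Finite.iff_fg.mpr ((chartForms_fg y i).pow n)
  rw [span_range_pow_eq_smul_map_chartForms_pow (hy.ne_zero i)]
  exact (Submodule.finrank_map_le _ _).trans (Submodule.finrank_map_le _ _)

/-- Multiplying by the common denominators of all charts gives sequences of forms that are regular
on every chart, and the saturation of the homogeneous coordinate ring has bounded denominators. -/
lemma exists_mul_pow_mul_mem_span_range_pow [Nonempty ι] (hy : IsCoordinateSystem k y)
    (hd : Algebra.trdeg k K ≠ 0) {V : ℕ → Submodule k K} (hV : HasBoundedPoles k y V) :
    ∃ h G : K, h ≠ 0 ∧ G ≠ 0 ∧ ∃ M m : ℕ, ∀ n, ∀ f ∈ V n,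
      h * G ^ n * f ∈ Submodule.span k (Set.range y) ^ (M * n + m) := by
  classical
  have := Fintype.ofFinite ι
  let L := Submodule.span k (Set.range y)
  choose b hb hb0 hbV using hV
  choose m hm using fun i => exists_pow_mul_mem_span_range_pow (hy.ne_zero i) (hb i)
  obtain ⟨j, hj⟩ := hy.exists_transcendental hd (Classical.arbitrary ι)
  obtain ⟨h, hh0, e, he⟩ := exists_mul_mem_span_pow_of_saturated (hy.ne_zero _) hj
  let s (i : ι) : K := y i ^ m i * b i
  refine ⟨h, ∏ i, s i, hh0, Finset.prod_ne_zero_iff.mpr fun i _ =>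
    mul_ne_zero (pow_ne_zero _ (hy.ne_zero i)) (hb0 i), ∑ i, m i, e, fun n f hf => ?_⟩
  rw [mul_assoc]
  refine he _ _ fun i => ?_
  obtain ⟨l, hl⟩ := exists_pow_mul_mem_span_range_pow (hy.ne_zero i) (hbV i n f hf)
  have hprod : ∏ j ∈ Finset.univ.erase i, s j ∈ L ^ ∑ j ∈ Finset.univ.erase i, m j :=
    SetLike.prod_mem_graded (fun n => L ^ n) m s fun j _ => hm j
  have hfactor : y i ^ l * ((∏ j, s j) ^ n * f) =
      (∏ j ∈ Finset.univ.erase i, s j) ^ n * (y i ^ (m i * n) * (y i ^ l * (b i ^ n * f))) := by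
    rw [← Finset.mul_prod_erase _ _ (Finset.mem_univ i), pow_mul]
    simp only [s]
    ring
  refine ⟨l, ?_⟩
  rw [hfactor, ← Finset.sum_erase_add _ _ (Finset.mem_univ i), add_mul, add_assoc, pow_add,
    pow_add, pow_mul]
  exact Submodule.mul_mem_mul (Submodule.pow_mem_pow _ hprod n)
    (Submodule.mul_mem_mul (pow_mem_span_range_pow _) hl)

end IsCoordinateSystem

namespace HasBoundedPoles

variable [Finite ι] [Nonempty ι] {V : ℕ → Submodule k K}

instance (n : ℕ) : Module.Finite k (Submodule.span k (Set.range y) ^ n : Submodule k K) :=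
  Module.Finite.iff_fg.mpr ((Submodule.fg_span (Set.finite_range _)).pow n)

lemma finite (hV : HasBoundedPoles k y V) (hy : IsCoordinateSystem k y)
    (hd : Algebra.trdeg k K ≠ 0) (n : ℕ) : Module.Finite k (V n) := by
  obtain ⟨h, G, hh, hG, M, m, hVM⟩ := hy.exists_mul_pow_mul_mem_span_range_pow hd hV
  exact finite_of_mul_mem (mul_ne_zero hh (pow_ne_zero n hG)) (hVM n)

lemma hasPolynomialGrowth_finrank (hV : HasBoundedPoles k y V) (hy : IsCoordinateSystem k y) {d : ℕ}
    (hd : Algebra.trdeg k K = d) (hd0 : d ≠ 0) :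
    HasPolynomialGrowth (fun n => Module.finrank k (V n)) d := by
  obtain ⟨h, G, hh, hG, M, m, hVM⟩ :=
    hy.exists_mul_pow_mul_mem_span_range_pow (by rw [hd]; exact_mod_cast hd0) hV
  exact ((hy.hasPolynomialGrowth_finrank_span_range_pow hd).comp_affine M m).of_le fun n =>
    finrank_le_of_mul_mem (mul_ne_zero hh (pow_ne_zero n hG)) (hVM n)

end HasBoundedPoles

end CoordinateSystem

section Growth

variable {k K ι : Type*} [Field k] [Field K] [Algebra k K] {y : ι → K} {V : ℕ → Submodule k K}

lemma pow_mul_mem_of_mem_pow {A : Subalgebra k K} {L : Submodule k K} {q : K}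
    (hq : ∀ z ∈ L, q * z ∈ A) {n : ℕ} {z : K} (hz : z ∈ L ^ n) : q ^ n * z ∈ A := by
  induction hz using Submodule.pow_induction_on_left' with
  | algebraMap c => simp
  | add z z' n _ _ hz hz' => rw [mul_add]; exact add_mem hz hz'
  | mem_mul m hm n z _ hz =>
    rw [Nat.succ_eq_add_one, show q ^ (n + 1) * (m * z) = q * m * (q ^ n * z) by ring]
    exact mul_mem (hq m hm) hz

lemma HasBoundedPoles.mul_pow (hV : HasBoundedPoles k y V) (hy : IsCoordinateSystem k y)
    {L : Submodule k K} (hL : L.FG) : HasBoundedPoles k y fun n => V n * L ^ n := by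
  intro i
  obtain ⟨b, hb, hb0, hbV⟩ := hV i
  have := hy.isFractionRing i
  obtain ⟨s, rfl⟩ := hL
  obtain ⟨⟨q, hq⟩, hqs⟩ :=
    IsLocalization.exist_integer_multiples_of_finset (nonZeroDivisors (chartAlgebra k y i)) s
  have hqL : ∀ z ∈ Submodule.span k (s : Set K), (q : K) * z ∈ chartAlgebra k y i := by
    suffices Submodule.span k (s : Set K) ≤
        (Subalgebra.toSubmodule (chartAlgebra k y i)).comap (LinearMap.mulLeft k (q : K)) from this
    refine Submodule.span_le.mpr fun z hz => ?_
    obtain ⟨w, hw⟩ := hqs z hz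
    have hwz : (w : K) = q * z := hw
    exact Submodule.mem_comap.mpr (hwz ▸ w.2 : (q : K) * z ∈ chartAlgebra k y i)
  have hq0 : (q : K) ≠ 0 := fun h => nonZeroDivisors.ne_zero hq (Subtype.ext h)
  refine ⟨b * q, mul_mem hb q.2, mul_ne_zero hb0 hq0, fun n f hf => ?_⟩
  induction hf using Submodule.mul_induction_on' with
  | mem_mul_mem f hf z hz =>
    rw [_root_.mul_pow, mul_mul_mul_comm]
    exact mul_mem (hbV n f hf) (pow_mul_mem_of_mem_pow hqL hz)
  | add f _ g _ hf hg => rw [mul_add]; exact add_mem hf hg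

lemma linearIndependent_prod_pow {R A σ : Type*} [CommRing R] [CommRing A] [Algebra R A]
    [Fintype σ] {x : σ → A} (hx : AlgebraicIndependent R x) :
    LinearIndependent R fun a : σ → ℕ => ∏ s, x s ^ a s := by
  have hlin := ((MvPolynomial.basisMonomials σ R).linearIndependent.map'
    (MvPolynomial.aeval x).toLinearMap (LinearMap.ker_eq_bot.mpr hx)).comp _
      Finsupp.equivFunOnFinite.symm.injective
  simpa [Function.comp_def, MvPolynomial.aeval_monomial, Finsupp.prod_fintype] using hlin

lemma linearIndependent_pow_of_transcendental {R A : Type*} [CommRing R] [CommRing A]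
    [Algebra R A] {x : A} (hx : Transcendental R x) : LinearIndependent R fun n : ℕ => x ^ n := by
  have hlin := linearIndependent_prod_pow (x := fun _ : Unit => x)
    (algebraicIndependent_unique_type_iff.mpr hx)
  simpa [Function.comp_def] using hlin.comp (fun n _ => n) fun _ _ h => congrFun h ()

lemma pow_mem_span_one_self_pow (x : K) {j n : ℕ} (hjn : j ≤ n) :
    x ^ j ∈ Submodule.span k {1, x} ^ n := by
  obtain ⟨l, rfl⟩ := Nat.exists_eq_add_of_le hjn
  rw [← mul_one (x ^ j), ← one_pow l, pow_add]
  exact Submodule.mul_mem_mul (Submodule.pow_mem_pow _ (Submodule.subset_span (by simp)) _)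
    (Submodule.pow_mem_pow _ (Submodule.subset_span (by simp)) _)

lemma succ_mul_finrank_le_finrank_mul_span_pow {A : Subalgebra k K} {x b : K} {W : Submodule k K}
    (hx : Transcendental A x) (hb : b ≠ 0) (hW : ∀ c ∈ W, c / b ∈ A) (n : ℕ)
    [Module.Finite k (W * Submodule.span k {1, x} ^ n : Submodule k K)] :
    (n + 1) * Module.finrank k W ≤
      Module.finrank k (W * Submodule.span k {1, x} ^ n : Submodule k K) := by
  have hmem (j : Fin (n + 1)) (c : K) (hc : c ∈ W) :
      c * x ^ (j : ℕ) ∈ W * Submodule.span k {1, x} ^ n :=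
    Submodule.mul_mem_mul hc (pow_mem_span_one_self_pow x (Nat.le_of_lt_succ j.2))
  have : Module.Finite k W := finite_of_mul_mem one_ne_zero fun c hc => by
    simpa using hmem 0 c hc
  let φ : (Fin (n + 1) → W) →ₗ[k] (W * Submodule.span k {1, x} ^ n : Submodule k K) :=
    ∑ j : Fin (n + 1), (LinearMap.mulRight k (x ^ (j : ℕ))).restrict (hmem j) ∘ₗ LinearMap.proj j
  have hφ (c : Fin (n + 1) → W) : (φ c : K) = ∑ j, (c j : K) * x ^ (j : ℕ) := by
    simp only [φ, LinearMap.sum_apply, AddSubmonoidClass.coe_finsetSum, LinearMap.comp_apply,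
      LinearMap.proj_apply]
    rfl
  have hinj : Function.Injective φ := by
    refine (injective_iff_map_eq_zero _).mpr fun c hc => ?_
    have hlin := (linearIndependent_pow_of_transcendental hx).comp (Fin.val : Fin (n + 1) → ℕ)
      Fin.val_injective
    have hzero := Fintype.linearIndependent_iff.mp hlin (fun j => ⟨c j / b, hW _ (c j).2⟩) <| by
      have hsum : ∑ j, (c j : K) * x ^ (j : ℕ) = 0 := by rw [← hφ, hc, ZeroMemClass.coe_zero]
      simp only [Function.comp_apply, Subalgebra.smul_def, smul_eq_mul, div_mul_eq_mul_div,
        ← Finset.sum_div, hsum, zero_div]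
    funext j
    have hj : (c j : K) / b = 0 := congrArg Subtype.val (hzero j)
    exact Subtype.ext ((div_eq_zero_iff.mp hj).resolve_right hb)
  simpa [Module.finrank_pi_fintype] using LinearMap.finrank_le_finrank_of_injective hinj

/-- The ratios of elements of the same positive degree. When `V` is a graded algebra, they generate
the field of degree-zero fractions of its subalgebra of positive degrees. -/
def ratioSet (V : ℕ → Submodule k K) : Set K :=
  {z | ∃ n, 0 < n ∧ ∃ a ∈ V n, ∃ b ∈ V n, b ≠ 0 ∧ z = a / b}

/-- If `x` were transcendental over the ratios of `V`, multiplying `V n` by the polynomials of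
degree at most `n` in `x` would multiply its dimension by `n + 1`. -/
lemma isAlgebraic_adjoin_ratioSet [Nonempty ι] [Finite ι] (hy : IsCoordinateSystem k y) {d : ℕ}
    (hd : Algebra.trdeg k K = d) (hd0 : d ≠ 0) (hV : HasBoundedPoles k y V)
    (hbig : ¬ HasPolynomialGrowth (fun n => (n + 1) * Module.finrank k (V n)) d) :
    Algebra.IsAlgebraic (Algebra.adjoin k (ratioSet V)) K := by
  refine ⟨fun x => by_contra fun hx => hbig ?_⟩
  have hVx := hV.mul_pow hy (L := Submodule.span k {1, x}) (Submodule.fg_span (by simp))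
  refine (hVx.hasPolynomialGrowth_finrank hy hd hd0).of_le fun n => ?_
  have := hVx.finite hy (by rw [hd]; exact_mod_cast hd0) n
  rcases Nat.eq_zero_or_pos n with rfl | hn
  · rw [pow_zero, mul_one, zero_add, one_mul]
  by_cases hbot : V n = ⊥
  · rw [hbot, finrank_bot, mul_zero]
    exact Nat.zero_le _
  obtain ⟨b, hb, hb0⟩ := Submodule.exists_mem_ne_zero_of_ne_bot hbot
  exact succ_mul_finrank_le_finrank_mul_span_pow hx hb0
    (fun c hc => Algebra.subset_adjoin ⟨n, hn, c, hc, b, hb, hb0, rfl⟩) n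

section GradedMonoid

variable [SetLike.GradedMonoid V] {σ : Type*} {z : σ → K}

lemma exists_common_denominator_mem [Finite σ] [Nonempty σ] (hz : ∀ s, z s ∈ ratioSet V) :
    ∃ N, 0 < N ∧ ∃ β ∈ V N, β ≠ 0 ∧ ∀ s, β * z s ∈ V N := by
  classical
  have := Fintype.ofFinite σ
  choose m hm a ha b hb hb0 hz using hz
  refine ⟨∑ s, m s, Finset.sum_pos (fun s _ => hm s) Finset.univ_nonempty, ∏ s, b s,
    SetLike.prod_mem_graded V m b fun s _ => hb s,
    Finset.prod_ne_zero_iff.mpr fun s _ => hb0 s, fun s => ?_⟩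
  have hmul : (∏ t, b t) * z s = a s * ∏ t ∈ Finset.univ.erase s, b t := by
    rw [← Finset.mul_prod_erase _ _ (Finset.mem_univ s), hz s, mul_right_comm,
      mul_div_cancel₀ _ (hb0 s)]
  rw [hmul, ← Finset.add_sum_erase _ _ (Finset.mem_univ s)]
  exact SetLike.mul_mem_graded (ha s) (SetLike.prod_mem_graded V m b fun t _ => hb t)

lemma pow_mul_prod_pow_mem [Fintype σ] {N : ℕ} {β : K} (hβ : β ∈ V N) (hz : ∀ s, β * z s ∈ V N)
    {r : ℕ} {a : σ → ℕ} (ha : ∀ s, a s ≤ r) :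
    β ^ (r * Fintype.card σ) * ∏ s, z s ^ a s ∈ V (N * Fintype.card σ * r) := by
  have hfactor (s : σ) : β ^ r * z s ^ a s ∈ V (N * r) := by
    have := SetLike.mul_mem_graded (SetLike.pow_mem_graded (r - a s) hβ)
      (SetLike.pow_mem_graded (a s) (hz s))
    rwa [← add_smul, Nat.sub_add_cancel (ha s), _root_.mul_pow, ← mul_assoc, ← pow_add,
      Nat.sub_add_cancel (ha s), smul_eq_mul, mul_comm r] at this
  have hprod := SetLike.prod_mem_graded V (fun _ : σ => N * r) _ (F := Finset.univ)
    fun s _ => hfactor s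
  rwa [Finset.prod_mul_distrib, Finset.prod_const, Finset.sum_const, Finset.card_univ, ← pow_mul,
    smul_eq_mul, show Fintype.card σ * (N * r) = N * Fintype.card σ * r by ring] at hprod

lemma pow_card_le_finrank [Fintype σ] {N : ℕ} {β : K} (hβ : β ∈ V N) (hβ0 : β ≠ 0)
    (hz : ∀ s, β * z s ∈ V N) (hind : AlgebraicIndependent k z) (r : ℕ)
    [Module.Finite k (V (N * Fintype.card σ * r))] :
    (r + 1) ^ Fintype.card σ ≤ Module.finrank k (V (N * Fintype.card σ * r)) := by
  let c := β ^ (r * Fintype.card σ)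
  have hlin : LinearIndependent k fun a : σ → Fin (r + 1) => c * ∏ s, z s ^ (a s : ℕ) :=
    ((linearIndependent_prod_pow hind).comp (fun (a : σ → Fin (r + 1)) s => (a s : ℕ))
      fun _ _ h => funext fun s => Fin.ext (congrFun h s)).map' (LinearMap.mulLeft k c)
        (LinearMap.ker_eq_bot.mpr (mul_right_injective₀ (pow_ne_zero _ hβ0)))
  have hlin' : LinearIndependent k fun a : σ → Fin (r + 1) =>
      (⟨_, pow_mul_prod_pow_mem hβ hz fun s => Nat.le_of_lt_succ (a s).2⟩ :
        V (N * Fintype.card σ * r)) :=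
    LinearIndependent.of_comp (Submodule.subtype _) hlin
  classical
  simpa using hlin'.fintype_card_le_finrank

/-- Up to a common factor, the graded algebra contains the polynomials in a transcendence basis of
`K` that consists of ratios. -/
theorem exists_pow_le_finrank [Nonempty ι] [Finite ι] (hy : IsCoordinateSystem k y) {d : ℕ}
    (hd : Algebra.trdeg k K = d) (hd0 : d ≠ 0) (hV : HasBoundedPoles k y V)
    (hbig : ¬ HasPolynomialGrowth (fun n => (n + 1) * Module.finrank k (V n)) d) :
    ∃ P, 0 < P ∧ ∀ r, (r + 1) ^ d ≤ Module.finrank k (V (P * r)) := by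
  have := isAlgebraic_adjoin_ratioSet hy hd hd0 hV hbig
  obtain ⟨T, hT, hbasis⟩ := exists_isTranscendenceBasis_subset (R := k) (ratioSet V)
  have hcard : Cardinal.mk T = d := by rw [hbasis.cardinalMk_eq_trdeg, hd]
  have : Finite T := Cardinal.lt_aleph0_iff_finite.mp (hcard ▸ Cardinal.natCast_lt_aleph0)
  have := Fintype.ofFinite T
  obtain rfl : Fintype.card T = d := by rwa [Cardinal.mk_fintype, Nat.cast_inj] at hcard
  have : Nonempty T := Fintype.card_pos_iff.mp (Nat.pos_of_ne_zero hd0)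
  obtain ⟨N, hN, β, hβ, hβ0, hβT⟩ := exists_common_denominator_mem fun z : T => hT z.2
  refine ⟨N * Fintype.card T, Nat.mul_pos hN Fintype.card_pos, fun r => ?_⟩
  have := hV.finite hy (by rw [hd]; exact_mod_cast hd0) (N * Fintype.card T * r)
  exact pow_card_le_finrank hβ hβ0 hβT hbasis.1 r

end GradedMonoid

end Growth

section OrderBound

variable {k K ι : Type*}

/-- `v` turns products of nonzero elements into sums, as the order of vanishing along a prime
divisor does. Its value at `0` is irrelevant. -/
def IsMultiplicativeOrder [MonoidWithZero K] (v : K → ℤ) : Prop :=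
  ∀ ⦃a b⦄, a ≠ 0 → b ≠ 0 → v (a * b) = v a + v b

lemma IsMultiplicativeOrder.map_one [MonoidWithZero K] [Nontrivial K] {v : K → ℤ}
    (hv : IsMultiplicativeOrder v) : v 1 = 0 := by
  have : v 1 = v 1 + v 1 := by simpa only [mul_one] using hv (one_ne_zero (α := K)) one_ne_zero
  lia

lemma IsMultiplicativeOrder.map_pow [MonoidWithZero K] [NoZeroDivisors K] [Nontrivial K]
    {v : K → ℤ} (hv : IsMultiplicativeOrder v) {a : K} (ha : a ≠ 0) (n : ℕ) :
    v (a ^ n) = n * v a := by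
  induction n with
  | zero => rw [pow_zero, hv.map_one, Nat.cast_zero, zero_mul]
  | succ n ih =>
    rw [pow_succ, hv (pow_ne_zero _ ha) ha, ih]
    push_cast
    ring

/-- `v` is an order of vanishing on the field `K` which, on the subalgebra `B`, is nonnegative and
is supported on the prime ideal `p`. -/
structure IsOrderAlong [CommSemiring k] [Field K] [Algebra k K] {B : Subalgebra k K} (p : Ideal B)
    (v : K → ℤ) : Prop where
  map_mul : IsMultiplicativeOrder v
  nonneg : ∀ x : B, x ≠ 0 → 0 ≤ v x
  eq_zero : ∀ x : B, x ≠ 0 → x ∉ p → v x = 0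

lemma le_totalDegree_of_pow_dvd {R σ : Type*} [CommRing R] [IsDomain R] {f g : MvPolynomial σ R}
    (hf : f.totalDegree ≠ 0) {r : ℕ} (h : f ^ r ∣ g) (hg : g ≠ 0) : r ≤ g.totalDegree := by
  have hf0 : f ≠ 0 := by rintro rfl; exact hf MvPolynomial.totalDegree_zero
  have hpow : (f ^ r).totalDegree = r * f.totalDegree := by
    induction r with
    | zero => simp
    | succ r ih =>
      rw [pow_succ, MvPolynomial.totalDegree_mul_of_isDomain (pow_ne_zero _ hf0) hf0,
        ih (dvd_of_mul_right_dvd (pow_succ f r ▸ h)), add_one_mul]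
  calc r ≤ r * f.totalDegree := Nat.le_mul_of_pos_right r (Nat.pos_of_ne_zero hf)
    _ = (f ^ r).totalDegree := hpow.symm
    _ ≤ g.totalDegree := MvPolynomial.totalDegree_le_of_dvd_of_isDomain h hg

/-- By going-down the contraction has height at most one. -/
lemma under_eq_bot_or_exists_prime {R B : Type*} [CommRing R] [IsDomain R] [IsNoetherianRing R]
    [UniqueFactorizationMonoid R] [CommRing B] [IsDomain B] [Algebra R B] [Module.Finite R B]
    [FaithfulSMul R B] (p : Ideal B) [p.IsPrime] (hp : p.height = 1) :
    p.under R = ⊥ ∨ ∃ π : R, Prime π ∧ p.under R = Ideal.span {π} := by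
  refine or_iff_not_imp_left.mpr fun hbot => ?_
  have := IsNoetherianRing.of_finite R B
  have hle : (p.under R).height ≤ 1 := by
    rw [← hp, Ideal.height_eq_height_add_of_liesOver_of_hasGoingDown (p.under R) p]
    exact le_self_add
  have hheight : (p.under R).height = 1 :=
    hle.antisymm <| Order.one_le_iff_ne_zero.mpr <| mt Ideal.height_eq_zero_iff_eq_bot.mp hbot
  obtain ⟨π, hπp, hπ⟩ := Ideal.IsPrime.exists_mem_prime_of_ne_bot inferInstance hbot
  exact ⟨π, hπ, Ideal.eq_span_singleton_of_height_eq_one hheight hπp hπ⟩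

variable [Field k] [Field K] [Algebra k K]

lemma IsOrderAlong.exists_le_totalDegree {σ : Type*} [Finite σ] {B : Subalgebra k K} {p : Ideal B}
    [p.IsPrime] {v : K → ℤ} (hv : IsOrderAlong p v) (hp : p.height = 1)
    (g : MvPolynomial σ k →ₐ[k] B) (hg : Function.Injective g) (hfin : g.Finite) :
    ∃ C : ℕ, ∀ a : MvPolynomial σ k, a ≠ 0 → v (g a) ≤ C * a.totalDegree := by
  let := g.toRingHom.toAlgebra
  have : Module.Finite (MvPolynomial σ k) B := hfin
  have : FaithfulSMul (MvPolynomial σ k) B := (faithfulSMul_iff_algebraMap_injective _ _).mpr hg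
  have hne {a : MvPolynomial σ k} (ha : a ≠ 0) : g a ≠ 0 := (map_ne_zero_iff g hg).mpr ha
  have hneK {a : MvPolynomial σ k} (ha : a ≠ 0) : (g a : K) ≠ 0 :=
    fun h => hne ha (Subtype.ext h)
  rcases under_eq_bot_or_exists_prime (R := MvPolynomial σ k) p hp with hbot | ⟨π, hπ, hspan⟩
  · refine ⟨0, fun a ha => ?_⟩
    have hap : g a ∉ p := fun h => ha (Ideal.mem_bot.mp (hbot ▸ Ideal.mem_comap.mpr h))
    rw [hv.eq_zero _ (hne ha) hap, Nat.cast_zero, zero_mul]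
  have hdeg : π.totalDegree ≠ 0 := by
    intro h
    have hC := MvPolynomial.totalDegree_eq_zero_iff_eq_C.mp h
    refine hπ.not_isUnit (hC ▸ (IsUnit.mk0 _ fun hzero => hπ.ne_zero ?_).map MvPolynomial.C)
    rw [hC, hzero, MvPolynomial.C_0]
  refine ⟨(v (g π)).toNat, fun a ha => ?_⟩
  obtain ⟨r, b, hπb, rfl⟩ := WfDvdMonoid.max_power_factor ha hπ.irreducible
  have hb : b ≠ 0 := right_ne_zero_of_mul ha
  have hbp : g b ∉ p := fun h =>
    hπb (Ideal.mem_span_singleton.mp (hspan ▸ Ideal.mem_comap.mpr h))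
  have hval : v (g (π ^ r * b)) = r * v (g π) := by
    rw [_root_.map_mul, _root_.map_pow, MulMemClass.coe_mul, SubmonoidClass.coe_pow,
      hv.map_mul (pow_ne_zero _ (hneK hπ.ne_zero)) (hneK hb),
      hv.map_mul.map_pow (hneK hπ.ne_zero), hv.eq_zero _ (hne hb) hbp, add_zero]
  have hnonneg : 0 ≤ v (g π) := hv.nonneg _ (hne hπ.ne_zero)
  rw [hval, Int.toNat_of_nonneg hnonneg, mul_comm]
  gcongr
  exact le_totalDegree_of_pow_dvd hdeg (dvd_mul_right _ _) ha

variable {y : ι → K} [Finite ι] {V : ℕ → Submodule k K} {v : K → ℤ} {i : ι}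
  {p : Ideal (chartAlgebra k y i)} [p.IsPrime]

/-- An element of `chartForms k y i ^ n` divides a polynomial of degree `O(n)` in the variables of a
Noether normalization. -/
lemma IsOrderAlong.exists_le_of_mem_chartForms_pow (hv : IsOrderAlong p v) (hp : p.height = 1)
    (hy : IsCoordinateSystem k y) {d : ℕ} (hd : Algebra.trdeg k K = d) :
    ∃ C : ℕ, ∀ n : ℕ, ∀ w ∈ chartForms k y i ^ n, w ≠ 0 → v w ≤ C * n := by
  obtain ⟨g, hg, hfin⟩ := hy.exists_noetherNormalization i hd
  obtain ⟨C₁, hC₁⟩ := hv.exists_le_totalDegree hp g hg hfin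
  let := g.toRingHom.toAlgebra
  have : IsScalarTower k (MvPolynomial (Fin d) k) (chartAlgebra k y i) :=
    .of_algebraMap_eq fun c => (g.commutes c).symm
  have : Module.Finite (MvPolynomial (Fin d) k) (chartAlgebra k y i) := hfin
  obtain ⟨C₂, hC₂⟩ := exists_dvd_algebraMap_of_mem_pow (σ := Fin d) (chartForms_fg (k := k) y i)
  refine ⟨C₁ * C₂, fun n w hw hw0 => ?_⟩
  obtain ⟨a, ha, hdeg, c, hc⟩ := hC₂ n w hw hw0
  have hc0 : c ≠ 0 := by
    rintro rfl
    exact (map_ne_zero_iff g hg).mpr ha (hc.trans (mul_zero w))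
  have hga : (g a : K) = w * c := congrArg Subtype.val hc
  calc v w ≤ v w + v c := le_add_of_nonneg_right (hv.nonneg c hc0)
    _ = v (g a) := by
      rw [hga, hv.map_mul (fun h => hw0 (Subtype.ext h)) fun h => hc0 (Subtype.ext h)]
    _ ≤ C₁ * a.totalDegree := hC₁ a ha
    _ ≤ (C₁ * C₂ : ℕ) * n := by
      rw [Nat.cast_mul, mul_assoc]
      gcongr
      exact_mod_cast hdeg

theorem IsOrderAlong.exists_le_of_hasBoundedPoles (hv : IsOrderAlong p v) (hp : p.height = 1)
    (hy : IsCoordinateSystem k y) {d : ℕ} (hd : Algebra.trdeg k K = d) (hd0 : d ≠ 0)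
    (hV : HasBoundedPoles k y V) :
    ∃ C : ℕ, ∀ n, ∀ f ∈ V n, f ≠ 0 → v f ≤ C * (n + 1) := by
  have : Nonempty ι := ⟨i⟩
  obtain ⟨C, hC⟩ := hv.exists_le_of_mem_chartForms_pow hp hy hd
  obtain ⟨h, G, hh, hG, M, m, hVM⟩ := hy.exists_mul_pow_mul_mem_span_range_pow
    (by rw [hd]; exact_mod_cast hd0) hV
  have hyi := hy.ne_zero i
  refine ⟨(M + m) * ((v (y i)).natAbs + C) + (v h).natAbs + (v G).natAbs, fun n f hf hf0 => ?_⟩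
  have hfmem := hVM n f hf
  rw [span_range_pow_eq_smul_map_chartForms_pow hyi] at hfmem
  obtain ⟨_, ⟨w, hw, rfl⟩, hfw⟩ := hfmem
  have hfw : y i ^ (M * n + m) * w = h * G ^ n * f := hfw
  have hw0 : w ≠ 0 := by
    rintro rfl
    rw [ZeroMemClass.coe_zero, mul_zero] at hfw
    exact mul_ne_zero (mul_ne_zero hh (pow_ne_zero n hG)) hf0 hfw.symm
  have hval : (M * n + m : ℕ) * v (y i) + v w = v h + n * v G + v f := by
    rw [← hv.map_mul.map_pow hyi, ← hv.map_mul (pow_ne_zero _ hyi) fun h => hw0 (Subtype.ext h),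
      hfw, hv.map_mul (mul_ne_zero hh (pow_ne_zero n hG)) hf0,
      hv.map_mul hh (pow_ne_zero n hG), hv.map_mul.map_pow hG]
  calc v f = (M * n + m : ℕ) * v (y i) + v w + -v h + n * -v G := by linarith
    _ ≤ (M * n + m : ℕ) * |v (y i)| + C * (M * n + m : ℕ) + |v h| + n * |v G| := by
      gcongr
      exacts [le_abs_self _, hC _ w hw hw0, neg_le_abs _, neg_le_abs _]
    _ = (M * n + m : ℕ) * (|v (y i)| + C) + |v h| + n * |v G| := by ring
    _ ≤ (M + m) * (n + 1) * (|v (y i)| + C) + |v h| * (n + 1) + (n + 1) * |v G| := by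
      gcongr ?_ * _ + ?_ + ?_ * _
      · push_cast
        nlinarith
      · exact le_mul_of_one_le_right (abs_nonneg _) (by linarith)
      · linarith
    _ = _ := by
      push_cast
      ring

end OrderBound

section Gap

lemma exists_bounded_add_mul_eq (S : Set ℕ) {M : ℕ} (hM : 0 < M) :
    ∃ R, ∀ n ∈ S, ∃ n' ∈ S, n' ≤ R ∧ ∃ q, n = n' + M * q := by
  have hresidue (s : ℕ) : ∃ R, ∀ n ∈ S, n % M = s → ∃ n' ∈ S, n' ≤ R ∧ ∃ q, n = n' + M * q := by
    by_cases h : ∃ n ∈ S, n % M = s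
    · classical
      obtain ⟨hmem, hmod⟩ := Nat.find_spec h
      refine ⟨Nat.find h, fun n hn hns => ⟨_, hmem, le_rfl, (n - Nat.find h) / M, ?_⟩⟩
      have hle : Nat.find h ≤ n := Nat.find_min' h ⟨hn, hns⟩
      rw [Nat.mul_div_cancel' ((Nat.modEq_iff_dvd' hle).mp (hmod.trans hns.symm)),
        Nat.add_sub_cancel' hle]
    · exact ⟨0, fun n hn hns => absurd ⟨n, hn, hns⟩ h⟩
  choose R hR using hresidue
  refine ⟨(Finset.range M).sup R, fun n hn => ?_⟩
  obtain ⟨n', hn', hle, hq⟩ := hR (n % M) n hn rfl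
  exact ⟨n', hn', hle.trans (Finset.le_sup (Finset.mem_range.mpr (Nat.mod_lt n hM))), hq⟩

/-- The number `l = n' + M * (n / R')` is a positive proportion of `n` in the residue class of `n`
modulo `M`, but much smaller than `j`. -/
lemma exists_eq_mul_add {m M : ℕ} (hm : m ∣ M) (hM : 0 < M) (c R : ℕ) :
    ∃ R' n₀, 0 < R' ∧ ∀ n ≥ n₀, ∀ n' ≤ R, ∀ q, n = n' + M * q →
      ∃ j, n = m * j + (n' + M * (n / R')) ∧ c * (n' + M * (n / R') + 1) ≤ j := by
  obtain ⟨P, rfl⟩ := hm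
  have hm0 : 0 < m := Nat.pos_of_mul_pos_right hM
  set Q := m * c + 1 with hQ
  refine ⟨2 * Q * (m * P), 2 * Q * (R + 1), by positivity, fun n hn n' hn' q hq => ?_⟩
  set r := n / (2 * Q * (m * P))
  have hl : Q * (n' + m * P * r + 1) ≤ n := by
    have hn'R : Q * (n' + 1) ≤ Q * (R + 1) := by gcongr
    have hrn : 2 * Q * (m * P) * r ≤ n := Nat.mul_div_le n _
    linarith
  have hrq : r ≤ q := by
    refine le_of_mul_le_mul_left (a := m * P) ?_ hM
    have hQ0 : 0 < Q := Nat.succ_pos _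
    have := Nat.le_mul_of_pos_left (n' + m * P * r + 1) hQ0
    linarith
  obtain ⟨s, rfl⟩ := Nat.exists_eq_add_of_le hrq
  have hn_eq : n = m * (P * s) + (n' + m * P * r) := by rw [hq]; ring
  refine ⟨P * s, hn_eq, le_of_mul_le_mul_left (a := m) ?_ hm0⟩
  rw [hQ] at hl
  linarith

variable {k K : Type*} [Field k]

section CommRing

variable [CommRing K] [IsDomain K] [Algebra k K]

lemma finrank_add_finrank_le {V V' W : Submodule k K} [Module.Finite k W] {a : K} (ha : a ≠ 0)
    (hVW : V ≤ W) (hV' : ∀ f ∈ V', a * f ∈ W) (hdisj : ∀ f ∈ V', f ≠ 0 → a * f ∉ V) :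
    Module.finrank k V + Module.finrank k V' ≤ Module.finrank k W := by
  let U := V'.map (LinearMap.mulLeft k a)
  have hU : U ≤ W := Submodule.map_le_iff_le_comap.mpr hV'
  have : Module.Finite k V := .of_injective _ (Submodule.inclusion_injective hVW)
  have : Module.Finite k U := .of_injective _ (Submodule.inclusion_injective hU)
  have hinf : V ⊓ U = ⊥ := by
    refine (Submodule.eq_bot_iff _).mpr ?_
    rintro _ ⟨hx, f, hf, rfl⟩
    by_contra hne
    exact hdisj f hf (right_ne_zero_of_mul hne) hx
  calc Module.finrank k V + Module.finrank k V'
      ≤ Module.finrank k V + Module.finrank k U := by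
        gcongr
        exact finrank_le_of_mul_mem ha fun f hf => ⟨f, hf, rfl⟩
    _ = Module.finrank k (V ⊔ U : Submodule k K) := by
        rw [← Submodule.finrank_sup_add_finrank_inf_eq V U, hinf, finrank_bot, add_zero]
    _ ≤ Module.finrank k W := Submodule.finrank_mono (sup_le hVW hU)

end CommRing

variable [Field K] [Algebra k K] {V W : ℕ → Submodule k K} {v : K → ℤ}

/-- The pole of `f ^ j` exceeds the poles allowed in `V` by a multiple of `j`, which the zeros of an
element of `V l` cannot compensate when `l` is small. -/
lemma exists_pow_mul_notMem (hv : IsMultiplicativeOrder v) {a : ℝ}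
    (hlower : ∀ n : ℕ, ∀ f ∈ V n, f ≠ 0 → -(n * a) ≤ v f) {C : ℕ}
    (hupper : ∀ n : ℕ, ∀ f ∈ V n, f ≠ 0 → v f ≤ C * (n + 1)) {m : ℕ} {f : K} (hf0 : f ≠ 0)
    (hvf : (v f : ℝ) < -(m * a)) :
    ∃ c : ℕ, ∀ j l, c * (l + 1) ≤ j → ∀ g ∈ V l, g ≠ 0 → f ^ j * g ∉ V (m * j + l) := by
  obtain ⟨δ, hδ, hδ0⟩ : ∃ δ : ℝ, δ = -(m * a) - v f ∧ 0 < δ := ⟨_, rfl, by linarith⟩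
  obtain ⟨c, hc⟩ := exists_nat_gt ((C + |a|) / δ)
  rw [div_lt_iff₀ hδ0] at hc
  refine ⟨c, fun j l hj g hg hg0 hmem => ?_⟩
  have hvg : (v g : ℝ) ≤ C * (l + 1) := by exact_mod_cast hupper l g hg hg0
  have hpole : -((m * j + l : ℕ) * a) ≤ (j * v f + v g : ℝ) := by
    have := hlower _ _ hmem (mul_ne_zero (pow_ne_zero j hf0) hg0)
    rw [hv (pow_ne_zero j hf0) hg0, hv.map_pow hf0] at this
    exact_mod_cast this
  have hjl : (c * (l + 1) : ℝ) ≤ j := by exact_mod_cast hj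
  have hjδ : j * δ ≤ (C + |a|) * (l + 1) := by
    have hle : j * δ ≤ l * a + C * (l + 1) := by
      rw [hδ]
      push_cast at hpole
      linarith
    have hla : l * a ≤ |a| * (l + 1) := by
      nlinarith [le_abs_self a, abs_nonneg a, (Nat.cast_nonneg l : (0 : ℝ) ≤ l)]
    linarith
  have hlt : (C + |a|) * (l + 1) < j * δ :=
    calc (C + |a|) * (l + 1) < c * δ * (l + 1) := by gcongr
      _ = c * (l + 1) * δ := by ring
      _ ≤ j * δ := by gcongr
  exact hjδ.not_gt hlt

lemma finrank_le_finrank_add_of_ne_bot [SetLike.GradedMul V] {n : ℕ} (hn : V n ≠ ⊥) (l : ℕ)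
    [Module.Finite k (V (n + l))] : Module.finrank k (V l) ≤ Module.finrank k (V (n + l)) := by
  obtain ⟨b, hb, hb0⟩ := Submodule.exists_mem_ne_zero_of_ne_bot hn
  exact finrank_le_of_mul_mem hb0 fun g hg => SetLike.mul_mem_graded hb hg

/-- For suitable `n = m * j + l` the subspace `f ^ j * V l` of `W n` meets `V n` only in zero, and
its dimension is a positive proportion of `n ^ d`. -/
theorem exists_finrank_add_pow_le [SetLike.GradedMul V] [SetLike.GradedMonoid W]
    (hVW : ∀ n, V n ≤ W n) (hfin : ∀ n, Module.Finite k (W n)) (hv : IsMultiplicativeOrder v)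
    {a : ℝ} (hlower : ∀ n : ℕ, ∀ f ∈ V n, f ≠ 0 → -(n * a) ≤ v f) {C : ℕ}
    (hupper : ∀ n : ℕ, ∀ f ∈ V n, f ≠ 0 → v f ≤ C * (n + 1)) {m : ℕ} (hm : 0 < m) {f : K}
    (hf0 : f ≠ 0) (hf : f ∈ W m) (hvf : (v f : ℝ) < -(m * a)) {d P : ℕ} (hP : 0 < P)
    (hgrowth : ∀ r, (r + 1) ^ d ≤ Module.finrank k (V (P * r))) :
    ∃ R n₀, 0 < R ∧ ∀ n ≥ n₀, V n ≠ ⊥ →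
      Module.finrank k (V n) + (n / R + 1) ^ d ≤ Module.finrank k (W n) := by
  obtain ⟨c, hc⟩ := exists_pow_mul_notMem hv hlower hupper hf0 hvf
  have hM : 0 < m * P := Nat.mul_pos hm hP
  obtain ⟨R₀, hR₀⟩ := exists_bounded_add_mul_eq {n | V n ≠ ⊥} hM
  obtain ⟨R, n₀, hR, hsplit⟩ := exists_eq_mul_add (dvd_mul_right m P) hM c R₀
  refine ⟨R, n₀, hR, fun n hn hVn => ?_⟩
  obtain ⟨n', hVn', hn', q, hq⟩ := hR₀ n hVn
  obtain ⟨j, hj, hcj⟩ := hsplit n hn n' hn' q hq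
  have hVfin (l : ℕ) : Module.Finite k (V l) :=
    have := hfin l
    .of_injective _ (Submodule.inclusion_injective (hVW l))
  have hdim : (n / R + 1) ^ d ≤ Module.finrank k (V (n' + m * P * (n / R))) :=
    calc (n / R + 1) ^ d ≤ (m * (n / R) + 1) ^ d := by
          gcongr
          exact Nat.le_mul_of_pos_left _ hm
      _ ≤ Module.finrank k (V (P * (m * (n / R)))) := hgrowth _
      _ = Module.finrank k (V (m * P * (n / R))) := by rw [← mul_assoc, mul_comm P m]
      _ ≤ Module.finrank k (V (n' + m * P * (n / R))) := finrank_le_finrank_add_of_ne_bot hVn' _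
  have := hfin n
  refine (Nat.add_le_add_left hdim _).trans <|
    finrank_add_finrank_le (pow_ne_zero j hf0) (hVW n) (fun g hg => ?_) fun g hg hg0 => ?_
  · rw [hj, mul_comm m j]
    exact SetLike.mul_mem_graded (SetLike.pow_mem_graded j hf) (hVW _ hg)
  · rw [hj]
    exact hc j _ hcj g hg hg0

end Gap

section Volume

open Filter Topology

/-- The volume `limsup_n a n / (n ^ d / d!)` of a sequence `a` of dimensions, so that `vol D` is the
volume of the sequence of dimensions of the spaces of sections of the multiples of `D`. -/
noncomputable def growthVolume (a : ℕ → ℕ) (d : ℕ) : ENNReal :=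
  limsup (fun n : ℕ => (a n : ENNReal) / ((n : ENNReal) ^ d / (d.factorial : ENNReal))) atTop

lemma natCast_div_pow_div_factorial (a d : ℕ) {n : ℕ} (hn : 0 < n) :
    (a : ENNReal) / ((n : ENNReal) ^ d / (d.factorial : ENNReal)) =
      ENNReal.ofReal (a / (n : ℝ) ^ d * d.factorial) := by
  have hfact : (0 : ℝ) < d.factorial := by exact_mod_cast d.factorial_pos
  rw [div_mul_eq_mul_div, ← div_div_eq_mul_div, ENNReal.ofReal_div_of_pos (by positivity),
    ENNReal.ofReal_div_of_pos hfact, ENNReal.ofReal_pow n.cast_nonneg]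
  simp only [ENNReal.ofReal_natCast]

lemma succ_pow_le_two_pow_mul_pow (d : ℕ) {n : ℕ} (hn : 0 < n) :
    (n + 1) ^ d ≤ 2 ^ d * n ^ d := by
  rw [← mul_pow]
  gcongr
  lia

/-- The growth hypothesis says that `a n = O(n ^ (d - 1))`, without subtraction. -/
lemma growthVolume_eq_zero {a : ℕ → ℕ} {d : ℕ}
    (ha : HasPolynomialGrowth (fun n => (n + 1) * a n) d) : growthVolume a d = 0 := by
  obtain ⟨C, hC⟩ := ha
  have hlim : Tendsto (fun n : ℕ => ENNReal.ofReal (C * 2 ^ d * (n : ℝ)⁻¹ * d.factorial)) atTop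
      (𝓝 0) := by
    rw [← ENNReal.ofReal_zero]
    refine ENNReal.tendsto_ofReal ?_
    simpa using
      ((tendsto_inv_atTop_nhds_zero_nat (𝕜 := ℝ)).const_mul (C * 2 ^ d : ℝ)).mul_const
        (d.factorial : ℝ)
  refine (tendsto_of_tendsto_of_tendsto_of_le_of_le' tendsto_const_nhds hlim
    (.of_forall fun _ => zero_le) ?_).limsup_eq
  filter_upwards [eventually_gt_atTop 0] with n hn
  have hbound : n * a n ≤ C * 2 ^ d * n ^ d :=
    calc n * a n ≤ (n + 1) * a n := by gcongr; lia
      _ ≤ C * (n + 1) ^ d := hC n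
      _ ≤ C * (2 ^ d * n ^ d) := by gcongr; exact succ_pow_le_two_pow_mul_pow d hn
      _ = C * 2 ^ d * n ^ d := by ring
  rw [natCast_div_pow_div_factorial _ _ hn]
  gcongr
  have hn' : (0 : ℝ) < n := by exact_mod_cast hn
  rw [← div_eq_mul_inv, div_le_div_iff₀ (by positivity) hn', mul_comm (a n : ℝ)]
  exact_mod_cast hbound

lemma growthVolume_ne_top {a : ℕ → ℕ} {d : ℕ} (ha : HasPolynomialGrowth a d) :
    growthVolume a d ≠ ⊤ := by
  obtain ⟨C, hC⟩ := ha
  refine ne_top_of_le_ne_top (ENNReal.ofReal_ne_top (r := C * 2 ^ d * d.factorial))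
    (limsup_le_of_le (by isBoundedDefault) ?_)
  filter_upwards [eventually_gt_atTop 0] with n hn
  have hbound : a n ≤ C * 2 ^ d * n ^ d :=
    calc a n ≤ C * (n + 1) ^ d := hC n
      _ ≤ C * (2 ^ d * n ^ d) := by gcongr; exact succ_pow_le_two_pow_mul_pow d hn
      _ = C * 2 ^ d * n ^ d := by ring
  rw [natCast_div_pow_div_factorial _ _ hn]
  gcongr
  rw [div_le_iff₀ (by positivity)]
  exact_mod_cast hbound

lemma limsup_lt_limsup_of_add_le {α : Type*} {l : Filter α} {u w : α → ENNReal} {c : ENNReal}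
    (hc : c ≠ 0) (huw : ∀ᶠ n in l, u n ≠ 0 → u n + c ≤ w n) (hpos : limsup u l ≠ 0)
    (htop : limsup u l ≠ ⊤) : limsup u l < limsup w l := by
  obtain ⟨ε, hε, hεc⟩ := exists_between (pos_iff_ne_zero.mpr hc)
  have hu : ∃ᶠ n in l, limsup u l - ε < u n :=
    frequently_lt_of_lt_limsup (by isBoundedDefault) (ENNReal.sub_lt_self htop hpos hε.ne')
  have hw : ∃ᶠ n in l, limsup u l - ε + c ≤ w n :=
    (hu.and_eventually huw).mono fun n ⟨hn, hun⟩ =>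
      (add_le_add_left hn.le c).trans (hun (ne_bot_of_gt hn))
  calc limsup u l ≤ limsup u l - ε + ε := le_tsub_add
    _ < limsup u l - ε + c :=
      ENNReal.add_lt_add_left (ne_top_of_le_ne_top htop tsub_le_self) hεc
    _ ≤ limsup w l := le_limsup_of_frequently_le hw (by isBoundedDefault)

lemma growthVolume_lt_of_add_pow_le {a b : ℕ → ℕ} {d R n₀ : ℕ} (hR : 0 < R)
    (ha : HasPolynomialGrowth a d) (hab : ∀ n ≥ n₀, a n ≠ 0 → a n + (n / R + 1) ^ d ≤ b n)
    (hpos : growthVolume a d ≠ 0) : growthVolume a d < growthVolume b d := by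
  have hc : 0 < ((R : ℝ) ^ d)⁻¹ * d.factorial := by
    have := d.factorial_pos
    positivity
  refine limsup_lt_limsup_of_add_le (ENNReal.ofReal_pos.mpr hc).ne' ?_ hpos
    (growthVolume_ne_top ha)
  filter_upwards [eventually_gt_atTop 0, eventually_ge_atTop n₀] with n hn hn₀ hun
  have han : a n ≠ 0 := by
    rintro h
    simp [h] at hun
  have hproportion : n ^ d ≤ R ^ d * (n / R + 1) ^ d := by
    rw [← mul_pow]
    gcongr
    exact (Nat.lt_mul_div_succ n hR).le
  have hreal : (a n / (n : ℝ) ^ d) + ((R : ℝ) ^ d)⁻¹ ≤ b n / (n : ℝ) ^ d := by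
    have hab' : (a n : ℝ) + ((n / R + 1 : ℕ) : ℝ) ^ d ≤ b n := by exact_mod_cast hab n hn₀ han
    have : (n : ℝ) ^ d ≤ R ^ d * ((n / R + 1 : ℕ) : ℝ) ^ d := by exact_mod_cast hproportion
    rw [le_div_iff₀ (by positivity), add_mul, div_mul_cancel₀ _ (by positivity)]
    exact (add_le_add_right ((inv_mul_le_iff₀ (by positivity)).mpr this) _).trans hab'
  rw [natCast_div_pow_div_factorial _ _ hn, natCast_div_pow_div_factorial _ _ hn,
    ← ENNReal.ofReal_add (by positivity) hc.le, ← add_mul]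
  gcongr

end Volume

section Hartogs

variable {R K : Type*} [CommRing R] [Field K] [Algebra R K] [IsFractionRing R K] {P : Ideal R}
  {z : K}

lemma mem_minimalPrimes_span_of_denominators [P.IsPrime]
    (hP : ∀ r, r ∈ P ↔ algebraMap R K r * z ∈ (algebraMap R K).range) {t w : R} (hw : w ∉ P)
    (htw : algebraMap R K w = algebraMap R K t * z) : P ∈ (Ideal.span {t}).minimalPrimes := by
  have ht : t ∈ P := (hP t).mpr ⟨w, htw⟩
  refine ⟨⟨‹_›, (Ideal.span_singleton_le_iff_mem P).mpr ht⟩, fun Q ⟨hQ, htQ⟩ hQP r hr => ?_⟩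
  obtain ⟨s, hs⟩ := (hP r).mp hr
  have hrw : r * w = s * t := by
    apply IsFractionRing.injective R K
    rw [map_mul, map_mul, htw, hs]
    ring
  have hrwQ : r * w ∈ Q := hrw ▸ Q.mul_mem_left s (htQ (Ideal.mem_span_singleton_self t))
  exact (hQ.mem_or_mem hrwQ).resolve_right fun hwQ => hw (hQP hwQ)

lemma ne_bot_of_denominators
    (hP : ∀ r, r ∈ P ↔ algebraMap R K r * z ∈ (algebraMap R K).range) : P ≠ ⊥ := by
  obtain ⟨a, b, hb, rfl⟩ := IsFractionRing.div_surjective (A := R) z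
  rintro rfl
  have := (algebraMap R K).domain_nontrivial
  refine nonZeroDivisors.ne_zero hb ((hP b).mpr ⟨a, ?_⟩)
  exact (mul_div_cancel₀ _ (IsFractionRing.to_map_ne_zero_of_mem_nonZeroDivisors hb)).symm

variable [IsNoetherianRing R] [IsIntegrallyClosed R]

/-- Otherwise multiplication by `z` preserves the finite module `P`, so that `z` is integral. -/
lemma exists_notMem_mul_of_denominators (hPtop : P ≠ ⊤)
    (hP : ∀ r, r ∈ P ↔ algebraMap R K r * z ∈ (algebraMap R K).range) :
    ∃ t, ∃ w ∉ P, algebraMap R K w = algebraMap R K t * z := by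
  by_contra! hstable
  have hint : IsIntegral R z := by
    refine isIntegral_of_smul_mem_submodule (M := K) (Submodule.map (Algebra.linearMap R K) P)
      ?_ (Submodule.FG.map _ (IsNoetherian.noetherian P)) z ?_
    · rw [← Submodule.map_bot (Algebra.linearMap R K)]
      exact (Submodule.map_injective_of_injective (IsFractionRing.injective R K)).ne
        (ne_bot_of_denominators hP)
    · rintro _ ⟨r, hr, rfl⟩
      obtain ⟨s, hs⟩ := (hP r).mp hr
      refine ⟨s, by_contra fun hsP => hstable r s hsP hs, ?_⟩
      simp only [Algebra.linearMap_apply, hs, smul_eq_mul, mul_comm]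
  obtain ⟨s, rfl⟩ := IsIntegrallyClosed.isIntegral_iff.mp hint
  exact hPtop ((Ideal.eq_top_iff_one P).mpr ((hP 1).mpr ⟨s, by rw [map_one, one_mul]⟩))

lemma height_eq_one_of_denominators [P.IsPrime]
    (hP : ∀ r, r ∈ P ↔ algebraMap R K r * z ∈ (algebraMap R K).range) : P.height = 1 := by
  obtain ⟨t, w, hw, htw⟩ := exists_notMem_mul_of_denominators (Ideal.IsPrime.ne_top ‹_›) hP
  refine le_antisymm (Ideal.height_le_one_of_isPrincipal_of_mem_minimalPrimes _ P
    (mem_minimalPrimes_span_of_denominators hP hw htw)) ?_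
  rw [Order.one_le_iff_ne_zero]
  have : IsDomain R := (IsFractionRing.injective R K).isDomain (algebraMap R K)
  exact fun h => ne_bot_of_denominators hP (Ideal.height_eq_zero_iff_eq_bot.mp h)

theorem mem_range_algebraMap_of_height_eq_one {x : K}
    (hx : ∀ p : Ideal R, p.IsPrime → p.height = 1 →
      ∃ b ∉ p, algebraMap R K b * x ∈ (algebraMap R K).range) : x ∈ (algebraMap R K).range := by
  by_contra hxR
  let N : Submodule R K := LinearMap.range (Algebra.linearMap R K)
  have hcolon (z : K) (r : R) :
      r ∈ (⊥ : Submodule R (K ⧸ N)).colon {N.mkQ z} ↔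
        algebraMap R K r * z ∈ (algebraMap R K).range := by
    rw [Submodule.mem_colon_singleton, ← map_smul, Submodule.mem_bot, Submodule.mkQ_apply,
      Submodule.Quotient.mk_eq_zero, Algebra.smul_def]
    rfl
  obtain ⟨P, hP, hle⟩ := exists_le_isAssociatedPrime_of_isNoetherianRing R (N.mkQ x) (by
    rwa [Submodule.mkQ_apply, Ne, Submodule.Quotient.mk_eq_zero])
  have := hP.1
  obtain ⟨-, z, hz⟩ := isAssociatedPrime_iff.mp hP
  obtain ⟨z, rfl⟩ := Submodule.mkQ_surjective N z
  have hheight : P.height = 1 := height_eq_one_of_denominators fun r => by rw [hz, hcolon]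
  obtain ⟨b, hbP, hb⟩ := hx P this hheight
  exact hbP (hle ((hcolon x b).mpr hb))

end Hartogs

section Order

variable {X : Scheme.{u}} [IsIntegral X] [IsLocallyNoetherian X] {z : X}

lemma isMultiplicativeOrder_ord (z : X) :
    IsMultiplicativeOrder fun f : X.functionField => Scheme.ord f z :=
  fun _ _ ha hb => Scheme.ord_mul ha hb

lemma ord_one (z : X) : Scheme.ord (1 : X.functionField) z = 0 :=
  IsMultiplicativeOrder.map_one (isMultiplicativeOrder_ord z)

lemma ord_algebraMap_section_nonneg {U : X.Opens} [Nonempty U] (hzU : z ∈ U) {s : Γ(X, U)}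
    (hs : s ≠ 0) :
    0 ≤ Scheme.ord (algebraMap Γ(X, U) X.functionField s) z := by
  simpa only [ord_one, Algebra.smul_def, mul_one] using Scheme.ord_le_smul hzU hs 1

section DiscreteValuationRing

variable (hz : coheight z = 1) [IsDiscreteValuationRing (X.presheaf.stalk z)]
include hz

lemma ord_nonneg_iff_mem_range_algebraMap_stalk {f : X.functionField} :
    0 ≤ Scheme.ord f z ↔ f ∈ (algebraMap (X.presheaf.stalk z) X.functionField).range := by
  rcases eq_or_ne f 0 with rfl | hf
  · simp only [Scheme.ord_zero, Pi.zero_apply, le_refl, zero_mem]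
  have := krullDimLE_of_coheight_le hz.le
  rw [Scheme.le_ord_iff hz hf, ofAdd_zero, WithZero.coe_one]
  change 1 ≤ Ring.ordFrac (X.presheaf.stalk z) f ↔ _
  rw [Ring.ordFrac_eq_valuation_inv, one_le_inv₀ (zero_lt_iff.mpr (by simpa using hf))]
  refine ⟨IsDiscreteValuationRing.exists_lift_of_le_one, ?_⟩
  rintro ⟨s, rfl⟩
  exact IsDedekindDomain.HeightOneSpectrum.valuation_le_one _ s

lemma ord_algebraMap_stalk_eq_zero_iff {s : X.presheaf.stalk z} (hs : s ≠ 0) :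
    Scheme.ord (algebraMap (X.presheaf.stalk z) X.functionField s) z = 0 ↔ IsUnit s := by
  have := krullDimLE_of_coheight_le hz.le
  rw [Scheme.ord_eq_iff hz ((FaithfulSMul.algebraMap_eq_zero_iff _ _).not.mpr hs)]
  exact Ring.isUnit_iff_ordFrac_one_of_isDiscreteValuationRing.symm

end DiscreteValuationRing

end Order

section AffineOpen

variable {X : Scheme.{u}} {U : X.Opens} (hU : IsAffineOpen U)

lemma height_primeIdealOf (x : U) : (hU.primeIdealOf x).asIdeal.height = coheight x.1 := by
  let := TopCat.Presheaf.algebra_section_stalk X.presheaf x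
  have := hU.isLocalization_stalk x
  have := IsLocalization.AtPrime.ringKrullDim_eq_height (hU.primeIdealOf x).asIdeal
    (X.presheaf.stalk x.1)
  rw [ringKrullDim_stalk_eq_coheight] at this
  exact_mod_cast this.symm

lemma primeIdealOf_surjective : Function.Surjective hU.primeIdealOf := fun p =>
  ⟨hU.isoSpec.inv p, by
    change (hU.isoSpec.inv ≫ hU.isoSpec.hom) p = p
    rw [Iso.inv_hom_id]
    rfl⟩

include hU in
lemma isIntegrallyClosed_of_isAffineOpen [IsIntegral X] [Nonempty U]
    (hX : ∀ x ∈ U, IsIntegrallyClosed (X.presheaf.stalk x)) : IsIntegrallyClosed Γ(X, U) := by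
  refine IsIntegrallyClosed.of_localization_maximal fun p _ hp => ?_
  obtain ⟨x, hx⟩ := primeIdealOf_surjective hU ⟨p, hp.isPrime⟩
  obtain rfl : (hU.primeIdealOf x).asIdeal = p := congrArg PrimeSpectrum.asIdeal hx
  let := TopCat.Presheaf.algebra_section_stalk X.presheaf x
  have := hU.isLocalization_stalk x
  exact (hX x.1 x.2).of_equiv
    (IsLocalization.algEquiv (hU.primeIdealOf x).asIdeal.primeCompl _ _).toRingEquiv

variable [IsIntegral X] [IsLocallyNoetherian X] [Nonempty U] {z : X}

lemma ord_algebraMap_section_eq_zero_iff (hzU : z ∈ U) (hz : coheight z = 1)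
    [IsDiscreteValuationRing (X.presheaf.stalk z)] {s : Γ(X, U)} (hs : s ≠ 0) :
    Scheme.ord (algebraMap Γ(X, U) X.functionField s) z = 0 ↔
      s ∉ (hU.primeIdealOf ⟨z, hzU⟩).asIdeal := by
  let := TopCat.Presheaf.algebra_section_stalk X.presheaf ⟨z, hzU⟩
  have := hU.isLocalization_stalk ⟨z, hzU⟩
  have hs' : X.presheaf.germ U z hzU s ≠ 0 := by
    rwa [Ne, map_eq_zero_iff _ (germ_injective_of_isIntegral _ _ _)]
  rw [← Ideal.mem_primeCompl_iff, ← IsLocalization.AtPrime.isUnit_to_map_iff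
    (X.presheaf.stalk z) (hU.primeIdealOf ⟨z, hzU⟩).asIdeal s]
  have := ord_algebraMap_stalk_eq_zero_iff hz hs'
  rwa [Scheme.algebraMap_germ_eq_germToFunctionField] at this

end AffineOpen

section Dimension

theorem ringKrullDim_eq_of_isIntegral (R S : Type*) [CommRing R] [CommRing S] [Algebra R S]
    [Algebra.IsIntegral R S] [FaithfulSMul R S] : ringKrullDim S = ringKrullDim R := by
  apply le_antisymm
  · exact krullDim_le_of_strictMono (PrimeSpectrum.comap (algebraMap R S))
      fun _ _ hIJ => Ideal.IsIntegral.comap_lt_comap hIJ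
  · refine iSup_le fun l => ?_
    obtain ⟨⟨P, _, _⟩⟩ := Ideal.nonempty_primesOver (S := S) l.head.asIdeal
    obtain ⟨L, hL, -, -⟩ := Ideal.exists_ltSeries_of_hasGoingUp l P
    rw [← hL]
    exact LTSeries.length_le_krullDim L

namespace IsCoordinateSystem

variable {k K ι : Type*} [Field k] [Field K] [Algebra k K] [Finite ι] {y : ι → K}

lemma trdeg_lt_aleph0 [Nonempty ι] (hy : IsCoordinateSystem k y) :
    Algebra.trdeg k K < Cardinal.aleph0 := by
  rw [← hy.trdeg_chartAlgebra (Classical.arbitrary ι)]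
  exact trdeg_lt_aleph0_of_finiteType

lemma ringKrullDim_chartAlgebra (hy : IsCoordinateSystem k y) {d : ℕ}
    (hd : Algebra.trdeg k K = d) (i : ι) : ringKrullDim (chartAlgebra k y i) = d := by
  obtain ⟨g, hg, hfin⟩ := hy.exists_noetherNormalization i hd
  let := g.toRingHom.toAlgebra
  have : Module.Finite (MvPolynomial (Fin d) k) (chartAlgebra k y i) := hfin
  have : FaithfulSMul (MvPolynomial (Fin d) k) (chartAlgebra k y i) :=
    (faithfulSMul_iff_algebraMap_injective _ _).mpr hg
  rw [ringKrullDim_eq_of_isIntegral (MvPolynomial (Fin d) k) (chartAlgebra k y i),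
    MvPolynomial.ringKrullDim_of_isNoetherianRing, ringKrullDim_eq_zero_of_field, Nat.card_fin,
    zero_add]

end IsCoordinateSystem

theorem topologicalKrullDim_eq_of_isAffineOpen {X : Scheme.{u}} {ι : Type*} [Nonempty ι]
    {U : ι → X.Opens} (hU : ∀ i, IsAffineOpen (U i)) (hcover : ∀ x, ∃ i, x ∈ U i)
    {d : WithBot ℕ∞} (hd : ∀ i, ringKrullDim Γ(X, U i) = d) : topologicalKrullDim X = d := by
  apply le_antisymm
  · rw [topologicalKrullDim, krullDim_eq_of_orderIso irreducibleSetEquivPoints,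
      krullDim_eq_iSup_coheight]
    refine iSup_le fun x => ?_
    obtain ⟨i, hi⟩ := hcover x
    rw [← height_primeIdealOf (hU i) ⟨x, hi⟩, ← hd i]
    exact Ideal.height_le_ringKrullDim_of_ne_top ((hU i).primeIdealOf ⟨x, hi⟩).isPrime.ne_top
  · let i : ι := Classical.arbitrary ι
    rw [← hd i, ← PrimeSpectrum.topologicalKrullDim_eq_ringKrullDim Γ(X, U i)]
    change topologicalKrullDim (Spec Γ(X, U i)) ≤ _
    rw [← IsHomeomorph.topologicalKrullDim_eq _ (hU i).isoSpec.hom.homeomorph.isHomeomorph]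
    exact topologicalKrullDim_subspace_le X (U i)

end Dimension

section VolumeComparison

variable {k K ι : Type*} [Field k] [Field K] [Algebra k K] [Finite ι] {y : ι → K} {i : ι}
  {p : Ideal (chartAlgebra k y i)} [p.IsPrime] {v : K → ℤ}

lemma IsCoordinateSystem.trdeg_ne_zero_of_height_eq_one (hy : IsCoordinateSystem k y)
    (hp : p.height = 1) {d : ℕ} (hd : Algebra.trdeg k K = d) : d ≠ 0 := by
  rintro rfl
  have h := Ideal.height_le_ringKrullDim_of_ne_top (‹p.IsPrime›.ne_top)
  rw [hp, hy.ringKrullDim_chartAlgebra hd] at h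
  exact absurd h (by decide)

theorem growthVolume_finrank_lt_of_order_lt (hy : IsCoordinateSystem k y) {d : ℕ}
    (hd : Algebra.trdeg k K = d) (hp : p.height = 1) (hv : IsOrderAlong p v)
    {V W : ℕ → Submodule k K} [SetLike.GradedMonoid V] [SetLike.GradedMonoid W]
    (hV : HasBoundedPoles k y V) (hW : HasBoundedPoles k y W) (hVW : ∀ n, V n ≤ W n)
    (hvol : growthVolume (fun n => Module.finrank k (V n)) d ≠ 0) {a : ℝ}
    (hlower : ∀ n : ℕ, ∀ f ∈ V n, f ≠ 0 → -(n * a) ≤ v f) {m : ℕ} (hm : 0 < m) {f : K}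
    (hf0 : f ≠ 0) (hf : f ∈ W m) (hvf : (v f : ℝ) < -(m * a)) :
    growthVolume (fun n => Module.finrank k (V n)) d <
      growthVolume (fun n => Module.finrank k (W n)) d := by
  have hι : Nonempty ι := ⟨i⟩
  have hd0 := hy.trdeg_ne_zero_of_height_eq_one hp hd
  have hfin := hW.finite hy (hd.trans_ne (Nat.cast_ne_zero.mpr hd0))
  obtain ⟨P, hP, hgrowth⟩ := exists_pow_le_finrank hy hd hd0 hV (mt growthVolume_eq_zero hvol)
  obtain ⟨C, hC⟩ := hv.exists_le_of_hasBoundedPoles hp hy hd hd0 hV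
  obtain ⟨R, n₀, hR, hadd⟩ :=
    exists_finrank_add_pow_le hVW hfin hv.map_mul hlower hC hm hf0 hf hvf hP hgrowth
  refine growthVolume_lt_of_add_pow_le (n₀ := n₀) hR
    (hV.hasPolynomialGrowth_finrank hy hd hd0) (fun n hn hne => hadd n hn ?_) hvol
  intro hbot
  exact hne (by rw [hbot, finrank_bot])

end VolumeComparison

section ProjSections

open HomogeneousLocalization

variable {A : Type u} [CommRing A] {σ : Type*} [SetLike σ A] [AddSubgroupClass σ A]
  (𝒜 : ℕ → σ) [GradedRing 𝒜]

lemma awayToSection_germ (f : A) (x : Proj 𝒜) (hx : x ∈ Proj.basicOpen 𝒜 f) :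
    Proj.awayToSection 𝒜 f ≫ (Proj 𝒜).presheaf.germ _ x hx =
      CommRingCat.ofHom (mapId 𝒜 (Submonoid.powers_le.mpr hx)) ≫ (Proj.stalkIso 𝒜 x).inv :=
  ProjectiveSpectrum.Proj.awayToSection_germ 𝒜 f x hx

variable {f : A} {m : ℕ} (hf : f ∈ 𝒜 m) (hm : 0 < m)
include hf hm

lemma basicOpen_ι_toSpecZero :
    (Proj.basicOpen 𝒜 f).ι ≫ Proj.toSpecZero 𝒜 =
      Proj.basicOpenToSpec 𝒜 f ≫ Spec.map (CommRingCat.ofHom (fromZeroRingHom 𝒜 _)) := by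
  rw [← Proj.basicOpenIsoSpec_hom 𝒜 f hf hm, ← Iso.inv_comp_eq,
    Proj.basicOpenIsoSpec_inv_ι_assoc, Proj.awayι_toSpecZero]

lemma toSpecZero_appTop_map_basicOpen :
    (Scheme.ΓSpecIso (.of (𝒜 0))).inv ≫ (Proj.toSpecZero 𝒜).appTop ≫
      (Proj 𝒜).presheaf.map (homOfLE (le_top : Proj.basicOpen 𝒜 f ≤ ⊤)).op =
      CommRingCat.ofHom (fromZeroRingHom 𝒜 _) ≫ Proj.awayToSection 𝒜 f := by
  have hι := congrArg Scheme.Hom.appTop (basicOpen_ι_toSpecZero 𝒜 hf hm)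
  have hres : (Proj.basicOpen 𝒜 f).ι.appTop ≫ (Proj.basicOpen 𝒜 f).topIso.hom =
      (Proj 𝒜).presheaf.map (homOfLE (le_top : Proj.basicOpen 𝒜 f ≤ ⊤)).op := by
    simp only [Scheme.Opens.ι_appTop, Scheme.Opens.topIso_hom]
    rfl
  have hspec := Proj.basicOpenToSpec_app_top 𝒜 f
  rw [Scheme.Hom.comp_appTop, Scheme.Hom.comp_appTop] at hι
  rw [← hres, reassoc_of% hι, ← Scheme.ΓSpecIso_inv_naturality_assoc, Scheme.Hom.appTop, hspec]
  simp only [Category.assoc, Iso.inv_hom_id, Category.comp_id, Iso.inv_hom_id_assoc]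

end ProjSections

section CoordinateQuotients

open HomogeneousLocalization MvPolynomial

variable {k : Type u} [Field k] {n : ℕ}

lemma X_mem_grading (j : Fin (n + 1)) : (X j : MvPolynomial (Fin (n + 1)) k) ∈ grading k n 1 :=
  isHomogeneous_X k j

lemma algebraMap_grading_zero_surjective :
    Function.Surjective (algebraMap k (grading k n 0)) := by
  rintro ⟨p, hp⟩
  have hdeg : p.totalDegree = 0 :=
    Nat.le_zero.mp (((mem_homogeneousSubmodule 0 p).mp hp).totalDegree_le)
  exact ⟨p.coeff 0, Subtype.ext (totalDegree_eq_zero_iff_eq_C.mp hdeg).symm⟩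

lemma adjoin_X_eq_top : Algebra.adjoin (grading k n 0)
    (Set.range (X : Fin (n + 1) → MvPolynomial (Fin (n + 1)) k)) = ⊤ := by
  rw [eq_top_iff]
  rintro p -
  induction p using MvPolynomial.induction_on with
  | C c => exact Subalgebra.algebraMap_mem _ (algebraMap k (grading k n 0) c)
  | add p q hp hq => exact add_mem hp hq
  | mul_X p i hp => exact mul_mem hp (Algebra.subset_adjoin (Set.mem_range_self i))

/-- The quotient `x_l / x_j` of two coordinates, as a function on the standard chart `D₊(x_j)` of
projective space. -/
noncomputable def coordDiv (k : Type u) [Field k] {n : ℕ} (j l : Fin (n + 1)) :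
    Away (grading k n) (X j : MvPolynomial (Fin (n + 1)) k) :=
  Away.mk (grading k n) (X_mem_grading j) 1 (X l)
    (by rw [smul_eq_mul, one_mul]; exact X_mem_grading l)

lemma val_coordDiv (j l : Fin (n + 1)) :
    (coordDiv k j l).val = Localization.mk (X l) ⟨X j, Submonoid.mem_powers _⟩ := by
  rw [coordDiv, Away.val_mk]
  congr 1
  exact Subtype.ext (pow_one _)

lemma mk_prod_X_pow_eq_prod_coordDiv (j : Fin (n + 1)) {a : ℕ} {e : Fin (n + 1) → ℕ}
    (he : ∑ l, e l = a)
    (h : ∏ l, (X l : MvPolynomial (Fin (n + 1)) k) ^ e l ∈ grading k n (a • 1)) :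
    Away.mk (grading k n) (X_mem_grading j) a (∏ l, X l ^ e l) h = ∏ l, coordDiv k j l ^ e l := by
  apply HomogeneousLocalization.val_injective
  rw [Away.val_mk, ← HomogeneousLocalization.algebraMap_apply, map_prod]
  simp only [map_pow, HomogeneousLocalization.algebraMap_apply, val_coordDiv, Localization.mk_pow]
  rw [Localization.mk_prod]
  congr 1
  apply Subtype.ext
  simp only [SubmonoidClass.mk_pow, SubmonoidClass.coe_finsetProd, Finset.prod_pow_eq_pow_sum, he]

lemma adjoin_coordDiv_eq_top (j : Fin (n + 1)) :
    Algebra.adjoin (grading k n 0) (Set.range (coordDiv k j)) = ⊤ := by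
  rw [eq_top_iff, ← Away.adjoin_mk_prod_pow_eq_top (X_mem_grading j) (Fin (n + 1))
    (X (R := k)) adjoin_X_eq_top (fun _ => 1) X_mem_grading]
  refine Algebra.adjoin_le ?_
  rintro _ ⟨a, e, he, -, rfl⟩
  rw [mk_prod_X_pow_eq_prod_coordDiv j (by simpa only [smul_eq_mul, mul_one] using he)]
  exact Subalgebra.prod_mem _ fun l _ => pow_mem (Algebra.subset_adjoin (Set.mem_range_self l)) _

variable {𝔭 : Ideal (MvPolynomial (Fin (n + 1)) k)} [𝔭.IsPrime]

/-- The quotient `x_l / x_j` in the homogeneous localization at a prime not containing `x_j`. -/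
noncomputable def coordDivAtPrime {j : Fin (n + 1)}
    (hj : (X j : MvPolynomial (Fin (n + 1)) k) ∉ 𝔭) (l : Fin (n + 1)) :
    HomogeneousLocalization.AtPrime (grading k n) 𝔭 :=
  mapId (grading k n) (Submonoid.powers_le.mpr hj) (coordDiv k j l)

variable {j : Fin (n + 1)} (hj : (X j : MvPolynomial (Fin (n + 1)) k) ∉ 𝔭) (l : Fin (n + 1))

lemma val_coordDivAtPrime : (coordDivAtPrime hj l).val = Localization.mk (X l) ⟨X j, hj⟩ := by
  rw [coordDivAtPrime, coordDiv]
  refine (congrArg val (map_mk _ _ _)).trans ?_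
  rw [val_mk]
  congr 1
  exact Subtype.ext (pow_one _)

lemma coordDivAtPrime_mul {i : Fin (n + 1)} (hi : (X i : MvPolynomial (Fin (n + 1)) k) ∉ 𝔭) :
    coordDivAtPrime hj l * coordDivAtPrime hi j = coordDivAtPrime hi l := by
  apply HomogeneousLocalization.val_injective
  rw [HomogeneousLocalization.val_mul, val_coordDivAtPrime, val_coordDivAtPrime,
    val_coordDivAtPrime, Localization.mk_mul, Localization.mk_eq_mk_iff, Localization.r_iff_exists]
  exact ⟨1, by simp only [OneMemClass.coe_one, one_mul, Submonoid.coe_mul]; ring⟩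

lemma isUnit_coordDivAtPrime_iff :
    IsUnit (coordDivAtPrime hj l) ↔ (X l : MvPolynomial (Fin (n + 1)) k) ∉ 𝔭 := by
  rw [← isUnit_iff_isUnit_val, val_coordDivAtPrime, Localization.mk_eq_mk',
    IsLocalization.AtPrime.isUnit_mk'_iff (Localization.AtPrime 𝔭) 𝔭]
  rfl

variable {K : Type u} [Field K] (φ : HomogeneousLocalization.AtPrime (grading k n) 𝔭 →+* K)

lemma map_coordDivAtPrime_ne_zero_iff [IsLocalHom φ] :
    φ (coordDivAtPrime hj l) ≠ 0 ↔ (X l : MvPolynomial (Fin (n + 1)) k) ∉ 𝔭 := by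
  rw [← isUnit_iff_ne_zero, isUnit_map_iff, isUnit_coordDivAtPrime_iff]

lemma map_coordDivAtPrime_div_map [IsLocalHom φ] {i : Fin (n + 1)}
    (hi : (X i : MvPolynomial (Fin (n + 1)) k) ∉ 𝔭) :
    φ (coordDivAtPrime hi l) / φ (coordDivAtPrime hi j) = φ (coordDivAtPrime hj l) := by
  rw [div_eq_iff ((map_coordDivAtPrime_ne_zero_iff hi j φ).mpr hj), ← map_mul,
    coordDivAtPrime_mul]

lemma range_comp_mapId_eq_adjoin [Algebra k K]
    (hφ : ∀ c, φ (mapId (grading k n) (Submonoid.powers_le.mpr hj)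
      (fromZeroRingHom (grading k n) _ (algebraMap k (grading k n 0) c))) = algebraMap k K c) :
    (φ.comp (mapId (grading k n) (Submonoid.powers_le.mpr hj))).range =
      (Algebra.adjoin k (Set.range fun l => φ (coordDivAtPrime hj l))).toSubring := by
  have hscalars : (φ.comp (mapId (grading k n) (Submonoid.powers_le.mpr hj))) ''
      Set.range (algebraMap (grading k n 0) (Away (grading k n) (X j))) =
        Set.range (algebraMap k K) := by
    rw [← Set.range_comp, ← algebraMap_grading_zero_surjective.range_comp]
    exact congrArg Set.range (funext hφ)
  rw [RingHom.range_eq_map, ← Algebra.top_toSubring (R := grading k n 0),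
    ← adjoin_coordDiv_eq_top j, Algebra.adjoin_eq_ring_closure, Algebra.adjoin_eq_ring_closure,
    RingHom.map_closure, Set.image_union, hscalars, ← Set.range_comp]
  rfl

end CoordinateQuotients

lemma chartAlgebra_subtype_ne_zero (k : Type*) {K ι : Type*} [CommSemiring k] [Semifield K]
    [Algebra k K] (y : ι → K) (i : {i // y i ≠ 0}) :
    chartAlgebra k (fun j : {j // y j ≠ 0} => y j) i = chartAlgebra k y i := by
  refine le_antisymm (Algebra.adjoin_mono ?_) (Algebra.adjoin_le ?_)
  · rintro _ ⟨j, rfl⟩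
    exact Set.mem_range_self j.1
  · rintro _ ⟨j, rfl⟩
    by_cases hj : y j = 0
    · simp only [hj, zero_div, SetLike.mem_coe, zero_mem]
    · exact Algebra.subset_adjoin ⟨⟨j, hj⟩, rfl⟩

section StalkMap

open HomogeneousLocalization

variable {A : Type u} [CommRing A] {σ : Type*} [SetLike σ A] [AddSubgroupClass σ A]
  {𝒜 : ℕ → σ} [GradedRing 𝒜] {X : Scheme.{u}} (i : X ⟶ Proj 𝒜) (x : X)

instance (z : Proj 𝒜) : z.asHomogeneousIdeal.toIdeal.IsPrime := z.isPrime

/-- The map on stalks at `x` of a morphism to `Proj 𝒜`, with the stalk of `Proj 𝒜` at `i x` written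
as a homogeneous localization. -/
noncomputable def stalkMapOfProj :
    HomogeneousLocalization.AtPrime 𝒜 (i x).asHomogeneousIdeal.toIdeal →+* X.presheaf.stalk x :=
  ((Proj.stalkIso 𝒜 (i x)).inv ≫ i.stalkMap x).hom

instance : IsLocalHom (stalkMapOfProj i x) := by
  have : IsLocalHom (i.stalkMap x).hom := inferInstance
  have : IsLocalHom (Proj.stalkIso 𝒜 (i x)).inv.hom := isLocalHom_of_isIso _
  exact RingHom.isLocalHom_comp _ _

variable {f : A} (hx : i x ∈ Proj.basicOpen 𝒜 f)

lemma stalkMapOfProj_mapId (z : Away 𝒜 f) :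
    stalkMapOfProj i x (mapId 𝒜 (Submonoid.powers_le.mpr hx) z) =
      X.presheaf.germ (i ⁻¹ᵁ Proj.basicOpen 𝒜 f) x hx (i.app _ (Proj.awayToSection 𝒜 f z)) := by
  have h : Proj.awayToSection 𝒜 f ≫ i.app _ ≫
      X.presheaf.germ (i ⁻¹ᵁ Proj.basicOpen 𝒜 f) x hx =
        CommRingCat.ofHom (mapId 𝒜 (Submonoid.powers_le.mpr hx)) ≫
          (Proj.stalkIso 𝒜 (i x)).inv ≫ i.stalkMap x := by
    rw [← reassoc_of% awayToSection_germ 𝒜 f (i x) hx, Scheme.Hom.germ_stalkMap]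
  exact congrArg (fun g => g.hom z) h.symm

variable {m : ℕ} (hf : f ∈ 𝒜 m) (hm : 0 < m)
include hf hm

lemma stalkMapOfProj_mapId_fromZeroRingHom (c : 𝒜 0) :
    stalkMapOfProj i x (mapId 𝒜 (Submonoid.powers_le.mpr hx) (fromZeroRingHom 𝒜 _ c)) =
      X.presheaf.germ ⊤ x trivial
        ((i ≫ Proj.toSpecZero 𝒜).appTop ((Scheme.ΓSpecIso (.of (𝒜 0))).inv c)) := by
  have h : CommRingCat.ofHom (fromZeroRingHom 𝒜 _) ≫ Proj.awayToSection 𝒜 f ≫ i.app _ ≫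
      X.presheaf.germ (i ⁻¹ᵁ Proj.basicOpen 𝒜 f) x hx =
        (Scheme.ΓSpecIso (.of (𝒜 0))).inv ≫ (i ≫ Proj.toSpecZero 𝒜).appTop ≫
          X.presheaf.germ ⊤ x trivial := by
    rw [← reassoc_of% toSpecZero_appTop_map_basicOpen 𝒜 hf hm, Scheme.Hom.comp_appTop,
      Scheme.Hom.naturality_assoc]
    simp only [Category.assoc]
    congr 3
    exact X.presheaf.germ_res _ x hx
  rw [stalkMapOfProj_mapId]
  exact congrArg (fun g => g.hom c) h

lemma range_stalkMapOfProj_comp_mapId [IsClosedImmersion i] :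
    ((stalkMapOfProj i x).comp (mapId 𝒜 (Submonoid.powers_le.mpr hx))).range =
      (X.presheaf.germ (i ⁻¹ᵁ Proj.basicOpen 𝒜 f) x hx).hom.range := by
  have haway : Function.Surjective (Proj.awayToSection 𝒜 f) :=
    (ConcreteCategory.bijective_of_isIso (Proj.basicOpenIsoAway 𝒜 f hf hm).hom).2
  have happ := i.app_surjective _ (Proj.isAffineOpen_basicOpen 𝒜 f hf hm)
  refine SetLike.coe_injective ?_
  rw [RingHom.coe_range, RingHom.coe_range, ← (happ.comp haway).range_comp]
  exact congrArg Set.range (funext (stalkMapOfProj_mapId i x hx))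

end StalkMap

end BigDivisor

namespace NormalProjectiveVariety

open BigDivisor

section AffineOpen

variable {k : Type u} [Field k] {V : NormalProjectiveVariety k} {U : V.X.Opens}
  (hU : IsAffineOpen U) [Nonempty U]
include hU

lemma mem_range_algebraMap_of_ord_nonneg {f : V.functionField}
    (hf : ∀ E : V.PrimeDivisor, E.1 ∈ U → 0 ≤ Scheme.ord f E.1) :
    f ∈ (algebraMap Γ(V.X, U) V.functionField).range := by
  have := functionField_isFractionRing_of_isAffineOpen V.X U hU
  have := BigDivisor.isIntegrallyClosed_of_isAffineOpen hU fun x _ => V.isNormal x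
  have : IsNoetherianRing Γ(V.X, U) := IsLocallyNoetherian.component_noetherian ⟨U, hU⟩
  refine BigDivisor.mem_range_algebraMap_of_height_eq_one fun p hp hp1 => ?_
  obtain ⟨z, hz⟩ := BigDivisor.primeIdealOf_surjective hU ⟨p, hp⟩
  obtain rfl : (hU.primeIdealOf z).asIdeal = p := congrArg PrimeSpectrum.asIdeal hz
  let E : V.PrimeDivisor := ⟨z.1, (BigDivisor.height_primeIdealOf hU z).symm.trans hp1⟩
  obtain ⟨s, rfl⟩ := (BigDivisor.ord_nonneg_iff_mem_range_algebraMap_stalk E.2).mp (hf E z.2)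
  let := TopCat.Presheaf.algebra_section_stalk V.X.presheaf z
  have := hU.isLocalization_stalk z
  obtain ⟨⟨a, b⟩, hab⟩ := IsLocalization.surj (hU.primeIdealOf z).asIdeal.primeCompl s
  refine ⟨b, b.2, a, ?_⟩
  have := congrArg (algebraMap (V.X.presheaf.stalk z.1) V.functionField) hab
  rw [map_mul, ← IsScalarTower.algebraMap_apply, ← IsScalarTower.algebraMap_apply] at this
  rw [← this, mul_comm]

lemma exists_one_le_ord_algebraMap (E : V.PrimeDivisor) : ∃ s : Γ(V.X, U), s ≠ 0 ∧
    (E.1 ∈ U → 1 ≤ Scheme.ord (algebraMap Γ(V.X, U) V.functionField s) E.1) := by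
  by_cases hE : E.1 ∈ U
  · have hne : (hU.primeIdealOf ⟨E.1, hE⟩).asIdeal ≠ ⊥ := by
      intro hbot
      have := BigDivisor.height_primeIdealOf hU ⟨E.1, hE⟩
      rw [hbot, Ideal.height_bot, E.2] at this
      exact zero_ne_one this
    obtain ⟨s, hs, hs0⟩ := Submodule.exists_mem_ne_zero_of_ne_bot hne
    refine ⟨s, hs0, fun _ => ?_⟩
    have hnonneg := BigDivisor.ord_algebraMap_section_nonneg hE hs0
    have hne_zero := (BigDivisor.ord_algebraMap_section_eq_zero_iff hU hE E.2 hs0).not_left.mpr hs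
    lia
  · exact ⟨1, one_ne_zero, fun h => absurd h hE⟩

lemma exists_le_ord_algebraMap (S : Finset V.PrimeDivisor) (N : ℕ) : ∃ b : Γ(V.X, U), b ≠ 0 ∧
    ∀ E ∈ S, E.1 ∈ U → N ≤ Scheme.ord (algebraMap Γ(V.X, U) V.functionField b) E.1 := by
  have hinj : Function.Injective (algebraMap Γ(V.X, U) V.functionField) :=
    V.X.germToFunctionField_injective U
  classical
  induction S using Finset.induction with
  | empty => exact ⟨1, one_ne_zero, by simp⟩
  | insert F S _ ih =>
    obtain ⟨b, hb0, hb⟩ := ih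
    obtain ⟨s, hs0, hs⟩ := exists_one_le_ord_algebraMap hU F
    have hsN := pow_ne_zero N hs0
    refine ⟨s ^ N * b, mul_ne_zero hsN hb0, fun E hE hEU => ?_⟩
    rw [map_mul, Scheme.ord_mul ((map_ne_zero_iff _ hinj).mpr hsN)
      ((map_ne_zero_iff _ hinj).mpr hb0)]
    rcases Finset.mem_insert.mp hE with rfl | hES
    · rw [map_pow, (BigDivisor.isMultiplicativeOrder_ord E.1).map_pow
        ((map_ne_zero_iff _ hinj).mpr hs0)]
      have := BigDivisor.ord_algebraMap_section_nonneg hEU hb0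
      nlinarith [hs hEU]
    · have := BigDivisor.ord_algebraMap_section_nonneg hEU hsN
      linarith [hb E hES hEU]

theorem exists_pow_mul_mem_range_of_mem_sections (D : V.RWeilDivisor) :
    ∃ b : Γ(V.X, U), b ≠ 0 ∧ ∀ n : ℕ, ∀ f ∈ V.sections (n • D),
      algebraMap Γ(V.X, U) V.functionField b ^ n * f ∈
        (algebraMap Γ(V.X, U) V.functionField).range := by
  obtain ⟨N, hN⟩ : ∃ N : ℕ, ∀ E ∈ D.support, D E ≤ N :=
    ⟨D.support.sup fun E => ⌈D E⌉₊, fun E hE => (Nat.le_ceil _).trans <|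
      Nat.cast_le.mpr (Finset.le_sup (f := fun E => ⌈D E⌉₊) hE)⟩
  obtain ⟨b, hb0, hb⟩ := exists_le_ord_algebraMap hU D.support N
  have hb0' : algebraMap Γ(V.X, U) V.functionField b ≠ 0 :=
    (map_ne_zero_iff _ (V.X.germToFunctionField_injective U)).mpr hb0
  refine ⟨b, hb0, fun n f hf => ?_⟩
  rcases eq_or_ne f 0 with rfl | hf0
  · rw [mul_zero]
    exact zero_mem _
  refine mem_range_algebraMap_of_ord_nonneg hU fun E hE => ?_
  rw [Scheme.ord_mul (pow_ne_zero n hb0') hf0,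
    (BigDivisor.isMultiplicativeOrder_ord E.1).map_pow hb0']
  have hDE : D E ≤ Scheme.ord (algebraMap Γ(V.X, U) V.functionField b) E.1 := by
    by_cases hED : E ∈ D.support
    · exact (hN E hED).trans (by exact_mod_cast hb E hED hE)
    · rw [Finsupp.notMem_support_iff.mp hED]
      exact_mod_cast BigDivisor.ord_algebraMap_section_nonneg hE hb0
  have hfE := hf hf0 E
  rw [Finsupp.smul_apply, nsmul_eq_mul] at hfE
  have : (0 : ℝ) ≤ n * Scheme.ord (algebraMap Γ(V.X, U) V.functionField b) E.1 +
      Scheme.ord f E.1 := by linarith [mul_le_mul_of_nonneg_left hDE n.cast_nonneg]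
  exact_mod_cast this

end AffineOpen

variable {k : Type u} [Field k] {V : NormalProjectiveVariety k}

/-- A finite affine cover of `V` by charts as in a projective embedding: there are nonzero rational
functions `y i`, the ratios of the homogeneous coordinates to a fixed one, such that the functions
on the `i`-th chart are the polynomials in the ratios `y j / y i`. -/
structure CoordinateAtlas (V : NormalProjectiveVariety k) where
  /-- The index set of the charts. -/
  ι : Type
  finite : Finite ι
  /-- The homogeneous coordinates, up to a common factor. -/
  y : ι → V.functionField
  ne_zero : ∀ i, y i ≠ 0
  /-- The charts. -/
  U : ι → V.X.Opens
  isAffineOpen : ∀ i, IsAffineOpen (U i)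
  nonempty_chart : ∀ i, Nonempty (U i)
  exists_mem : ∀ x, ∃ i, x ∈ U i
  range_algebraMap : ∀ i, (algebraMap Γ(V.X, U i) V.functionField).range =
    (chartAlgebra k y i).toSubring

lemma genericPoint_mem {U : V.X.Opens} {x : V.X} (hx : x ∈ U) : genericPoint V.X ∈ U :=
  ((genericPoint_spec V.X).mem_open_set_iff U.isOpen).mpr ⟨x, trivial, hx⟩

lemma exists_mem_basicOpen_X {n : ℕ} (z : projectiveSpace k n) :
    ∃ j : Fin (n + 1), z ∈ Proj.basicOpen (grading k n) (MvPolynomial.X j) := by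
  rw [← TopologicalSpace.Opens.mem_iSup, Proj.iSup_basicOpen_eq_top' (𝒜 := grading k n)
    (MvPolynomial.X : Fin (n + 1) → MvPolynomial (Fin (n + 1)) k)
    (fun j => ⟨1, X_mem_grading j⟩) adjoin_X_eq_top]
  trivial

section Embedding

open HomogeneousLocalization

variable {n : ℕ} (i : V.X ⟶ projectiveSpace k n) (hi : i ≫ projectiveSpaceStr k n = V.str)
  {j : Fin (n + 1)}
  (hj : i (genericPoint V.X) ∈ Proj.basicOpen (grading k n) (MvPolynomial.X j))

include hi in
lemma stalkMapOfProj_scalars (c : k) :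
    stalkMapOfProj i (genericPoint V.X) (mapId (grading k n) (Submonoid.powers_le.mpr hj)
      (fromZeroRingHom (grading k n) _ (algebraMap k (grading k n 0) c))) =
        algebraMap k V.functionField c := by
  have h : (Scheme.ΓSpecIso (CommRingCat.of k)).inv ≫ V.str.appTop =
      CommRingCat.ofHom (algebraMap k (grading k n 0)) ≫
        (Scheme.ΓSpecIso (.of (grading k n 0))).inv ≫
          (i ≫ Proj.toSpecZero (grading k n)).appTop := by
    rw [← hi, projectiveSpaceStr, Scheme.ΓSpecIso_inv_naturality_assoc, ← Scheme.Hom.comp_appTop,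
      Category.assoc]
  rw [stalkMapOfProj_mapId_fromZeroRingHom i _ hj (X_mem_grading j) one_pos]
  exact congrArg (fun g => V.X.presheaf.germ ⊤ (genericPoint V.X) trivial (g.hom c)) h.symm

include hi in
lemma range_algebraMap_preimage_basicOpen_X [IsClosedImmersion i]
    [Nonempty (i ⁻¹ᵁ Proj.basicOpen (grading k n) (MvPolynomial.X j))] :
    (algebraMap Γ(V.X, i ⁻¹ᵁ Proj.basicOpen (grading k n) (MvPolynomial.X j))
      V.functionField).range =
        (Algebra.adjoin k (Set.range fun l =>
          stalkMapOfProj i (genericPoint V.X) (coordDivAtPrime hj l))).toSubring := by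
  rw [← range_comp_mapId_eq_adjoin hj _ (stalkMapOfProj_scalars i hi hj)]
  exact (range_stalkMapOfProj_comp_mapId i _ hj (X_mem_grading j) one_pos).symm

end Embedding

theorem nonempty_coordinateAtlas : Nonempty V.CoordinateAtlas := by
  obtain ⟨n, i, hclosed, hi⟩ := V.isProjective
  obtain ⟨j₀, hj₀⟩ := exists_mem_basicOpen_X (i (genericPoint V.X))
  let φ := stalkMapOfProj i (genericPoint V.X)
  let y : Fin (n + 1) → V.functionField := fun l => φ (coordDivAtPrime hj₀ l)
  let U : Fin (n + 1) → V.X.Opens := fun l =>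
    i ⁻¹ᵁ Proj.basicOpen (grading k n) (MvPolynomial.X l)
  have mem_iff (l) : y l ≠ 0 ↔ genericPoint V.X ∈ U l :=
    map_coordDivAtPrime_ne_zero_iff hj₀ l φ
  refine ⟨⟨{l // y l ≠ 0}, inferInstance, fun l => y l, fun l => l.2, fun l => U l,
    fun l => (Proj.isAffineOpen_basicOpen _ _ (X_mem_grading l.1) one_pos).preimage i,
    fun l => ⟨⟨_, (mem_iff l).mp l.2⟩⟩, fun x => ?_, fun l => ?_⟩⟩
  · obtain ⟨j, hj⟩ := exists_mem_basicOpen_X (i x)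
    exact ⟨⟨j, (mem_iff j).mpr (genericPoint_mem hj)⟩, hj⟩
  · have hl := (mem_iff l).mp l.2
    have : Nonempty (U l) := ⟨⟨_, hl⟩⟩
    rw [range_algebraMap_preimage_basicOpen_X i hi hl, chartAlgebra_subtype_ne_zero k y l,
      chartAlgebra, funext fun m => map_coordDivAtPrime_div_map hl m φ hj₀]

namespace CoordinateAtlas

variable (A : V.CoordinateAtlas)

instance : Finite A.ι := A.finite

instance (i : A.ι) : Nonempty (A.U i) := A.nonempty_chart i

instance : Nonempty A.ι := (A.exists_mem (genericPoint V.X)).nonempty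

/-- The functions on a chart, identified with a subring of the function field. -/
noncomputable def sectionsEquiv (i : A.ι) : Γ(V.X, A.U i) ≃+* chartAlgebra k A.y i :=
  (RingEquiv.ofBijective (algebraMap Γ(V.X, A.U i) V.functionField).rangeRestrict
    ⟨fun _ _ h => V.X.germToFunctionField_injective (A.U i) (congrArg Subtype.val h),
      RingHom.rangeRestrict_surjective _⟩).trans (RingEquiv.subringCongr (A.range_algebraMap i))

lemma coe_sectionsEquiv (i : A.ι) (s : Γ(V.X, A.U i)) :
    (A.sectionsEquiv i s : V.functionField) = algebraMap Γ(V.X, A.U i) V.functionField s :=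
  rfl

lemma algebraMap_sectionsEquiv_symm (i : A.ι) (s : chartAlgebra k A.y i) :
    algebraMap Γ(V.X, A.U i) V.functionField ((A.sectionsEquiv i).symm s) = s := by
  rw [← coe_sectionsEquiv, RingEquiv.apply_symm_apply]

lemma isCoordinateSystem : IsCoordinateSystem k A.y where
  ne_zero := A.ne_zero
  isFractionRing i := by
    have := functionField_isFractionRing_of_isAffineOpen V.X (A.U i) (A.isAffineOpen i)
    refine IsFractionRing.of_field _ _ fun z => ?_
    obtain ⟨a, b, -, rfl⟩ := IsFractionRing.div_surjective (A := Γ(V.X, A.U i)) z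
    refine ⟨A.sectionsEquiv i a, A.sectionsEquiv i b, ?_⟩
    rfl

include A in
lemma trdeg_eq_dim : Algebra.trdeg k V.functionField = V.dim := by
  obtain ⟨d, hd⟩ := Cardinal.lt_aleph0.mp A.isCoordinateSystem.trdeg_lt_aleph0
  have hdim : topologicalKrullDim V.X = d :=
    topologicalKrullDim_eq_of_isAffineOpen A.isAffineOpen A.exists_mem fun i => by
      rw [ringKrullDim_eq_of_ringEquiv (A.sectionsEquiv i),
        A.isCoordinateSystem.ringKrullDim_chartAlgebra hd]
  rw [hd, dim, hdim]
  rfl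

lemma hasBoundedPoles_sections (D : V.RWeilDivisor) :
    HasBoundedPoles k A.y fun n => V.sections (n • D) := by
  intro i
  obtain ⟨b, hb0, hb⟩ := exists_pow_mul_mem_range_of_mem_sections (A.isAffineOpen i) D
  have hmem (x : V.functionField) (hx : x ∈ (algebraMap Γ(V.X, A.U i) V.functionField).range) :
      x ∈ chartAlgebra k A.y i := by rwa [A.range_algebraMap] at hx
  exact ⟨_, hmem _ ⟨b, rfl⟩, (map_ne_zero_iff _ (V.X.germToFunctionField_injective _)).mpr hb0,
    fun n f hf => hmem _ (hb n f hf)⟩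

variable {A} {i : A.ι} {E : V.PrimeDivisor} (hE : E.1 ∈ A.U i)

/-- The prime ideal of a prime divisor in the coordinate ring of a chart that meets it. -/
noncomputable def primeIdeal : Ideal (chartAlgebra k A.y i) :=
  ((A.isAffineOpen i).primeIdealOf ⟨E.1, hE⟩).asIdeal.comap (A.sectionsEquiv i).symm

instance : (primeIdeal hE).IsPrime := Ideal.comap_isPrime _ _

lemma height_primeIdeal : (primeIdeal hE).height = 1 := by
  have h := height_primeIdealOf (A.isAffineOpen i) ⟨E.1, hE⟩
  rw [E.2] at h
  rw [primeIdeal, RingEquiv.height_comap, h]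

lemma isOrderAlong_ord :
    IsOrderAlong (primeIdeal hE) fun f : V.functionField => Scheme.ord f E.1 where
  map_mul := isMultiplicativeOrder_ord E.1
  nonneg s hs := by
    rw [← A.algebraMap_sectionsEquiv_symm]
    exact ord_algebraMap_section_nonneg hE (EmbeddingLike.map_ne_zero_iff.mpr hs)
  eq_zero s hs hsE := by
    rw [← A.algebraMap_sectionsEquiv_symm]
    exact (ord_algebraMap_section_eq_zero_iff (A.isAffineOpen i) hE E.2
      (EmbeddingLike.map_ne_zero_iff.mpr hs)).mpr hsE

end CoordinateAtlas

lemma mem_sections_nsmul_iff {D : V.RWeilDivisor} {n : ℕ} {f : V.functionField} :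
    f ∈ V.sections (n • D) ↔
      (f ≠ 0 → ∀ E : V.PrimeDivisor, 0 ≤ (Scheme.ord f E.1 : ℝ) + n * D E) := by
  change (f ≠ 0 → ∀ E : V.PrimeDivisor, 0 ≤ (Scheme.ord f E.1 : ℝ) + (n • D) E) ↔ _
  simp only [Finsupp.smul_apply, nsmul_eq_mul]

lemma sections_mono {D D' : V.RWeilDivisor} (h : D ≤ D') : V.sections D ≤ V.sections D' :=
  fun _ hf hf0 E => (hf hf0 E).trans (add_le_add_right (h E) _)

instance gradedMonoid_sections (D : V.RWeilDivisor) :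
    SetLike.GradedMonoid fun n : ℕ => V.sections (n • D) where
  one_mem := mem_sections_nsmul_iff.mpr fun _ E => by
    rw [ord_one, Int.cast_zero, Nat.cast_zero, zero_mul, add_zero]
  mul_mem m n f g hf hg := by
    rw [mem_sections_nsmul_iff] at *
    intro hfg E
    obtain ⟨hf0, hg0⟩ := mul_ne_zero_iff.mp hfg
    have hfE := hf hf0 E
    have hgE := hg hg0 E
    rw [Scheme.ord_mul hf0 hg0]
    push_cast
    linarith

theorem vol_lt_vol_of_mem_sections {D₁ D₂ : V.RWeilDivisor} (hD₁ : V.IsBig D₁) (hle : D₁ ≤ D₂)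
    {m : ℕ} {f : V.functionField} (hf : f ∈ V.sections (m • D₂)) (hf' : f ∉ V.sections (m • D₁)) :
    V.vol D₁ < V.vol D₂ := by
  simp only [mem_sections_nsmul_iff, not_forall, not_le] at hf'
  obtain ⟨hf0, E, hE⟩ := hf'
  have hm : 0 < m := by
    refine Nat.pos_of_ne_zero ?_
    rintro rfl
    have := mem_sections_nsmul_iff.mp hf hf0 E
    simp only [Nat.cast_zero, zero_mul] at this hE
    exact hE.not_ge this
  obtain ⟨A⟩ := nonempty_coordinateAtlas (V := V)
  obtain ⟨i, hi⟩ := A.exists_mem E.1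
  refine growthVolume_finrank_lt_of_order_lt A.isCoordinateSystem A.trdeg_eq_dim
    (CoordinateAtlas.height_primeIdeal hi) (CoordinateAtlas.isOrderAlong_ord hi)
    (A.hasBoundedPoles_sections D₁) (A.hasBoundedPoles_sections D₂)
    (fun n => sections_mono (nsmul_le_nsmul_right hle n)) hD₁.ne' (a := D₁ E)
    (fun n g hg hg0 => ?_) hm hf0 hf (by linarith)
  linarith [mem_sections_nsmul_iff.mp hg hg0 E]

end NormalProjectiveVariety

theorem mainTheorem11 {k : Type u} [Field k] (V : NormalProjectiveVariety k)
    (D₁ D₂ : V.RWeilDivisor) (hD₁ : V.IsBig D₁) (hD₂ : V.IsBig D₂)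
    (hle : D₁ ≤ D₂) (hvol : V.vol D₁ = V.vol D₂) (n : ℕ) :
    V.sections (n • D₁) = V.sections (n • D₂) := by
  refine le_antisymm (NormalProjectiveVariety.sections_mono (nsmul_le_nsmul_right hle n))
    fun f hf => ?_
  by_contra hf'
  exact (NormalProjectiveVariety.vol_lt_vol_of_mem_sections hD₁ hle hf hf').ne hvol
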